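/- Let $g\in\mathbb{C}[x]$ be a separable polynomial of degree $8$, and let $C$ be the nonsingular projective model of the curve $y^2=g(x)$, a hyperelliptic curve of genus $3$ over $\mathbb{C}$. For a point $P$ of $C$, let $v_P$ be the normalized valuation at $P$, and for a nonzero meromorphic $2$-differential $\omega=h\,(dt)^2$, with $t$ a local parameter at $P$, put $\operatorname{ord}_P(\omega)=v_P(h)$. Let $H^0(C,(\Omega^1)^2)$ be the complex vector space of holomorphic $2$-differentials on $C$ and let $d$ be its dimension. If $\psi_1,\dots,\psi_d$ is a basis of this space with $\operatorname{ord}_P(\psi_1)<\cdots<\operatorname{ord}_P(\psi_d)$, then the sequence of the numbers $n_i=\operatorname{ord}_P(\psi_i)+1$, $1\le i\le d$, is called the $2$-gap sequence of $P$; the $2$-weight of $P$ is $\sum_{i=1}^{d}(n_i-i)$, and $P$ is a $2$-Weierstrass point if its $2$-weight is positive. Corollary. Let $P$ be a finite non-branch point of $C$, that is, a point with $x(P)=w\in\mathbb{C}$ and $y(P)=s\in\mathbb{C}$, where $g(w)\neq0$ (so $s^2=g(w)\ne 0$). Let $f_w(x)=\sum_{n=0}^{4}\frac{\varphi^{(n)}(w)}{n!}(x-w)^n$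 be the Taylor polynomial of degree at most $4$ at $w$ of the holomorphic branch $\varphi$ of $\sqrt{g}$ near $w$ with $\varphi(w)=s$. Put $$n_6=v_{P}\bigl(y-f_w(x)\bigr)+1 .$$ Then $n_6$ is a natural number and the following hold. 1. The $2$-differentials $$\frac{(x-w)^j}{y^2}(dx)^2\quad(0\le j\le 4),\qquad \frac{y-f_w(x)}{y^2}(dx)^2$$ form a basis of $H^0(C,(\Omega^1)^2)$; in this order, their orders at $P$ are strictly increasing and, increased by $1$, equal to $1,2,3,4,5,n_6$. 2. The $2$-gap sequence of $P$ is $\{1,2,3,4,5,n_6\}$, and it does not depend on the choice of the basis $\psi_1,\dots,\psi_d$ in its definition. 3. If $n_6>6$, then $P$ is a $2$-Weierstrass point, and its $2$-weight is $n_6-6$. -/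

import Mathlib

open Polynomial
open scoped TensorProduct WithZero

noncomputable section

namespace QWeierstrass

/-! ### Points of the nonsingular projective model of a function field over the complex numbers -/

/-- A point of the nonsingular projective curve with function field `K`, viewed as its local ring:
a discrete valuation ring of `K` that contains the constants. -/
structure Point (K : Type*) [Field K] [Algebra ℂ K] where
  ring : ValuationSubring K
  algebraMap_mem : ∀ c : ℂ, algebraMap ℂ K c ∈ ring
  isDVR : IsDiscreteValuationRing ring

attribute [instance] Point.isDVR

namespace Point

variable {K : Type*} [Field K] [Algebra ℂ K] (P : Point K)

/-- The normalized valuation at `P`, written multiplicatively. -/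
def val : Valuation K ℤᵐ⁰ :=
  (IsDiscreteValuationRing.maximalIdeal P.ring).valuation K

/-- The order `v_P(z)` of a nonzero function `z` at `P` (with the convention `v_P(0) = 0`). -/
def ord (z : K) : ℤ := -WithZero.log (P.val z)

/-- The function `z` is regular at `P` and takes the value `c` there, that is, `z - c` lies in the
maximal ideal of the local ring at `P`. -/
def HasValue (z : K) (c : ℂ) : Prop := P.val (z - algebraMap ℂ K c) < 1

/-- A local parameter at `P`. -/
def parameter : K :=
  ((IsDiscreteValuationRing.exists_irreducible P.ring).choose : P.ring)

end Point

/-! ### `q`-differentials -/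

section Differentials

variable (K : Type*) [Field K] [Algebra ℂ K]

/-- Meromorphic `q`-differentials: the `q`-th tensor power, over the function field, of its module
of Kähler differentials (which is one-dimensional over a function field of one variable). -/
abbrev QDiff (q : ℕ) : Type _ := ⨂[K]^q (Ω[K⁄ℂ])

variable {K}

/-- The `q`-differential `(dz)^q`. -/
def dPow (q : ℕ) (z : K) : QDiff K q :=
  PiTensorProduct.tprod K fun _ : Fin q => KaehlerDifferential.D ℂ K z

/-- The function `h` with `ω = h (dt)^q`, where `t` is the local parameter at `P`. -/
def Point.coeff (P : Point K) {q : ℕ} (ω : QDiff K q) : K :=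
  Classical.epsilon fun h : K => ω = h • dPow q P.parameter

/-- The order `ord_P(ω)` of a nonzero `q`-differential `ω = h (dt)^q` at `P`, namely `v_P(h)`. -/
def Point.qOrd (P : Point K) {q : ℕ} (ω : QDiff K q) : ℤ := P.ord (P.coeff ω)

/-- The `q`-differential `ω` is holomorphic at `P`: `ω = h (dt)^q` with `h` regular at `P`. -/
def Point.HolomorphicAt (P : Point K) {q : ℕ} (ω : QDiff K q) : Prop :=
  ∃ h ∈ P.ring, ω = h • dPow q P.parameter

variable (K)

/-- The complex vector space `H⁰(C, (Ω¹)^q)` of holomorphic `q`-differentials. -/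
def H0 (q : ℕ) : Submodule ℂ (QDiff K q) where
  carrier := {ω | ∀ P : Point K, P.HolomorphicAt ω}
  zero_mem' := fun P => ⟨0, P.ring.zero_mem, by rw [zero_smul]⟩
  add_mem' := by
    intro a b ha hb P
    obtain ⟨h, hh, rfl⟩ := ha P
    obtain ⟨k, hk, rfl⟩ := hb P
    exact ⟨h + k, P.ring.add_mem _ _ hh hk, by rw [add_smul]⟩
  smul_mem' := by
    intro c a ha P
    obtain ⟨h, hh, rfl⟩ := ha P
    exact ⟨c • h, by
      rw [Algebra.smul_def]
      exact P.ring.mul_mem _ _ (P.algebraMap_mem c) hh, by rw [smul_assoc]⟩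

variable {K}

/-- `n` is the `q`-gap sequence of `P`: for some basis `ψ` of the space of holomorphic
`q`-differentials with `ord_P(ψ₁) < ord_P(ψ₂) < ⋯`, one has `nᵢ = ord_P(ψᵢ) + 1`.
The indices run through `Fin d`, so they start at `0`. -/
def Point.IsGapSequence (P : Point K) (q : ℕ) {d : ℕ} (n : Fin d → ℕ) : Prop :=
  ∃ ψ : Module.Basis (Fin d) ℂ (H0 K q),
    StrictMono (fun i => P.qOrd (ψ i : QDiff K q)) ∧
      ∀ i, (n i : ℤ) = P.qOrd (ψ i : QDiff K q) + 1

/-- `k` is the `q`-weight of `P`, the sum of the `nᵢ - i` over the `q`-gap sequence, where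
`i = 1, …, d`. -/
def Point.HasWeight (P : Point K) (q : ℕ) (k : ℤ) : Prop :=
  ∃ (d : ℕ) (n : Fin d → ℕ), P.IsGapSequence q n ∧ k = ∑ i, ((n i : ℤ) - ((i : ℤ) + 1))

/-- `P` is a `q`-Weierstrass point: its `q`-weight is positive. -/
def Point.IsWeierstrass (P : Point K) (q : ℕ) : Prop := ∃ k, P.HasWeight q k ∧ 0 < k

end Differentials

/-! ### The curves `y² = g(x)` with `g` separable of degree `8` -/

/-- A separable complex polynomial of degree `8`, defining the genus three hyperelliptic curve
`y² = g(x)`. -/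
structure Octic where
  g : ℂ[X]
  separable : g.Separable
  natDegree_eq : g.natDegree = 8

namespace Octic

variable (C : Octic)

/-- The polynomial `Y² - g(x)` over the rational function field `ℂ(x)`. -/
def equation : (RatFunc ℂ)[X] := X ^ 2 - Polynomial.C (algebraMap ℂ[X] (RatFunc ℂ) C.g)

theorem irreducible_equation : Irreducible C.equation := by
  refine X_pow_sub_C_irreducible_of_prime Nat.prime_two fun b hb => ?_
  obtain ⟨p, rfl⟩ := IsIntegrallyClosed.exists_algebraMap_eq_of_isIntegral_pow (R := ℂ[X])
    (x := b) (n := 2) (by norm_num) (hb ▸ isIntegral_algebraMap)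
  rw [← map_pow] at hb
  have hp : p ^ 2 = C.g := IsFractionRing.injective ℂ[X] (RatFunc ℂ) hb
  have hu : IsUnit p := C.separable.squarefree p ⟨1, by rw [← hp]; ring⟩
  have h8 := C.natDegree_eq
  rw [← hp, natDegree_pow, natDegree_eq_zero_of_isUnit hu] at h8
  omega

instance : Fact (Irreducible C.equation) := ⟨C.irreducible_equation⟩

/-- The function field `ℂ(x, y)` of the curve `y² = g(x)`. -/
abbrev FunctionField : Type := AdjoinRoot C.equation

/-- The coordinate function `x`. -/
def x : C.FunctionField := algebraMap (RatFunc ℂ) C.FunctionField RatFunc.X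

/-- The coordinate function `y`. -/
def y : C.FunctionField := AdjoinRoot.root C.equation

theorem y_sq : C.y ^ 2 = aeval C.x C.g := by
  have h : aeval C.y C.equation = 0 := by rw [y, AdjoinRoot.aeval_eq, AdjoinRoot.mk_self]
  have h1 : aeval C.x C.g = algebraMap (RatFunc ℂ) C.FunctionField
      (algebraMap ℂ[X] (RatFunc ℂ) C.g) := by
    rw [x, aeval_algebraMap_apply, ← RatFunc.algebraMap_X, aeval_algebraMap_apply,
      aeval_X_left_apply]
  have h2 : aeval C.y (X ^ 2 - Polynomial.C (algebraMap ℂ[X] (RatFunc ℂ) C.g)) = 0 := h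
  rw [map_sub, map_pow, aeval_X, aeval_C, sub_eq_zero] at h2
  rw [h1, h2]

/-- The local branch at `w` of the function `√g` that takes the value `s` at `w`, where `(w, s)` is
a point of the curve with `g(w) = s² ≠ 0`. -/
def branch (w s : ℂ) (z : ℂ) : ℂ := s * (C.g.eval z / C.g.eval w) ^ (1 / 2 : ℂ)

theorem branch_self {w : ℂ} (s : ℂ) (hw : C.g.eval w ≠ 0) : C.branch w s w = s := by
  simp [branch, div_self hw]

theorem branch_sq {w s : ℂ} (hw : C.g.eval w ≠ 0) (hs : s ^ 2 = C.g.eval w) (z : ℂ) :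
    C.branch w s z ^ 2 = C.g.eval z := by
  have h : ((C.g.eval z / C.g.eval w) ^ (1 / 2 : ℂ)) ^ 2 = C.g.eval z / C.g.eval w := by
    rw [← Complex.cpow_nat_mul]
    norm_num
  rw [branch, mul_pow, h, hs, mul_div_cancel₀ _ hw]

theorem branch_analyticAt {w : ℂ} (s : ℂ) (hw : C.g.eval w ≠ 0) :
    AnalyticAt ℂ (C.branch w s) w := by
  have hg : AnalyticAt ℂ (fun z => C.g.eval z) w :=
    C.g.differentiable.analyticAt w
  refine analyticAt_const.mul ((hg.div analyticAt_const hw).cpow analyticAt_const ?_)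
  simp [div_self hw]

/-- The Taylor polynomial at `w` of degree at most `4` of the local branch of `√g` through
`(w, s)`. -/
def taylorPoly (w s : ℂ) : ℂ[X] :=
  ∑ n ∈ Finset.range 5,
    Polynomial.C (iteratedDeriv n (C.branch w s) w / (n.factorial : ℂ)) * (X - Polynomial.C w) ^ n

/-- The six `2`-differentials `(x - w)^j (dx)² / y²` for `0 ≤ j ≤ 4` and
`(y - f(x)) (dx)² / y²`, where `f` is the Taylor polynomial at `(w, s)`. -/
def basisDiff (w s : ℂ) : Fin 6 → QDiff C.FunctionField 2 :=
  Fin.snoc (α := fun _ => QDiff C.FunctionField 2)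
    (fun j : Fin 5 => ((C.x - algebraMap ℂ C.FunctionField w) ^ (j : ℕ) / C.y ^ 2) • dPow 2 C.x)
    (((C.y - aeval C.x (C.taylorPoly w s)) / C.y ^ 2) • dPow 2 C.x)

end Octic

end QWeierstrass

end

/-! The differential dx/y has neither zeros nor poles at finite points, and at a point at infinity
its order is twice that of 1/x. Hence F (dx)²/y² is holomorphic exactly when F is regular at all
finite points and F/x⁴ is regular at infinity (`Octic.mem_H0_iff`). Such F are the functions p(x) +
c y with deg p ≤ 4 and c constant (`Octic.eq_aeval_add_of_forall_point`), a space of dimension 6.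

Near P the function x - w is a local parameter, so (x - w)^j has order j. Since (y - f)(y + f) = g -
f² is divisible by (x - w)⁵ and y + f takes the value 2s ≠ 0, the order of y - f is at least 5
(`Octic.ord_basisFun`). The six orders are distinct, which gives independence; Taylor expansion at w
gives spanning. Any basis with increasing orders realises all orders of nonzero holomorphic
differentials, so the gap sequence is unique (`Octic.qOrd_basis_unique`).

The local computations avoid completions: `Point.val_derivation` compares a candidate τ with the
chosen local parameter by writing functions as powers of τ times units from a coordinate ring. It is
applied in the chart (x, y) and in the chart (1/x, y/x⁴). -/

noncomputable section

namespace QWeierstrass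

/-! ### Values, local parameters and derivations at a point -/

namespace Point

variable {K : Type*} [Field K] [Algebra ℂ K] (P : Point K)

theorem val_le_one_iff {z : K} : P.val z ≤ 1 ↔ z ∈ P.ring := by
  constructor
  · intro h
    obtain ⟨a, rfl⟩ := IsDiscreteValuationRing.exists_lift_of_le_one h
    exact a.2
  · intro h
    exact IsDedekindDomain.HeightOneSpectrum.valuation_le_one
      (IsDiscreteValuationRing.maximalIdeal P.ring) (⟨z, h⟩ : P.ring)

theorem val_algebraMap {c : ℂ} (hc : c ≠ 0) : P.val (algebraMap ℂ K c) = 1 := by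
  refine le_antisymm (P.val_le_one_iff.2 (P.algebraMap_mem c)) ?_
  have h := P.val_le_one_iff.2 (P.algebraMap_mem c⁻¹)
  rw [map_inv₀, map_inv₀] at h
  exact (inv_le_one₀ (zero_lt_iff.2 (by simpa using hc))).1 h

theorem val_algebraMap_le (c : ℂ) : P.val (algebraMap ℂ K c) ≤ 1 :=
  P.val_le_one_iff.2 (P.algebraMap_mem c)

theorem val_parameter : P.val P.parameter = WithZero.exp (-1 : ℤ) := by
  have h := (IsDiscreteValuationRing.exists_irreducible P.ring).choose_spec
  have h1 := IsDedekindDomain.HeightOneSpectrum.intValuation_singleton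
    (IsDiscreteValuationRing.maximalIdeal P.ring) h.ne_zero h.maximalIdeal_eq
  rw [← h1]
  exact IsDedekindDomain.HeightOneSpectrum.valuation_of_algebraMap _ _

theorem eq_zero_of_val_algebraMap_lt {c : ℂ} (h : P.val (algebraMap ℂ K c) < 1) : c = 0 := by
  by_contra hc
  exact h.ne (P.val_algebraMap hc)

variable {P}

theorem val_le_exp_neg_one {z : K} (h : P.val z < 1) : P.val z ≤ WithZero.exp (-1 : ℤ) := by
  rcases eq_or_ne (P.val z) 0 with h0 | h0
  · simp [h0]
  · rw [← WithZero.exp_log h0, WithZero.exp_le_exp]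
    rw [← WithZero.exp_log h0, ← WithZero.exp_zero, WithZero.exp_lt_exp] at h
    omega

theorem HasValue.mem {z : K} {c : ℂ} (h : P.HasValue z c) : z ∈ P.ring := by
  have h1 := P.ring.add_mem _ _ (P.val_le_one_iff.1 h.le) (P.algebraMap_mem c)
  simpa using h1

theorem HasValue.val_eq_one {z : K} {c : ℂ} (h : P.HasValue z c) (hc : c ≠ 0) : P.val z = 1 := by
  have h1 : P.val (z - algebraMap ℂ K c) < P.val (algebraMap ℂ K c) := by
    rw [P.val_algebraMap hc]; exact h
  have h2 := Valuation.map_add_eq_of_lt_left P.val h1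
  rwa [add_sub_cancel, P.val_algebraMap hc] at h2

theorem HasValue.unique {z : K} {c d : ℂ} (h : P.HasValue z c) (h' : P.HasValue z d) : c = d := by
  have h1 : P.val (algebraMap ℂ K (c - d)) < 1 := by
    rw [map_sub, ← sub_sub_sub_cancel_left _ _ z]
    exact Valuation.map_sub_lt P.val h' h
  exact sub_eq_zero.1 (P.eq_zero_of_val_algebraMap_lt h1)

theorem hasValue_algebraMap (c : ℂ) : P.HasValue (algebraMap ℂ K c) c := by
  simp [HasValue]

theorem HasValue.add {z z' : K} {c d : ℂ} (h : P.HasValue z c) (h' : P.HasValue z' d) :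
    P.HasValue (z + z') (c + d) := by
  have : z + z' - algebraMap ℂ K (c + d) =
    (z - algebraMap ℂ K c) + (z' - algebraMap ℂ K d) := by rw [map_add]; ring
  rw [HasValue, this]
  exact Valuation.map_add_lt P.val h h'

theorem HasValue.mul {z z' : K} {c d : ℂ} (h : P.HasValue z c) (h' : P.HasValue z' d) :
    P.HasValue (z * z') (c * d) := by
  have : z * z' - algebraMap ℂ K (c * d) =
    (z - algebraMap ℂ K c) * z' + algebraMap ℂ K c * (z' - algebraMap ℂ K d) := by
    rw [map_mul]; ring
  rw [HasValue, this]
  refine Valuation.map_add_lt P.val ?_ ?_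
  · rw [map_mul]
    exact mul_lt_one_of_lt_of_le h (P.val_le_one_iff.2 h'.mem)
  · rw [map_mul]
    exact mul_lt_one_of_nonneg_of_lt_one_right (P.val_algebraMap_le c) zero_le h'

theorem HasValue.aeval {z : K} {c : ℂ} (h : P.HasValue z c) (p : ℂ[X]) :
    P.HasValue (Polynomial.aeval z p) (p.eval c) := by
  induction p using Polynomial.induction_on' with
  | add p q hp hq => simpa using hp.add hq
  | monomial n a =>
    rw [aeval_monomial, eval_monomial]
    refine (hasValue_algebraMap a).mul ?_
    induction n with
    | zero => simpa using hasValue_algebraMap (P := P) 1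
    | succ n ih => rw [pow_succ, pow_succ]; exact ih.mul h

/-- If `y² = G(x)` and `x` has a value at `P`, then so has `y`. -/
theorem HasValue.exists_of_sq {x y : K} {G : ℂ[X]} {w : ℂ} (hx : P.HasValue x w)
    (hy : y ^ 2 = Polynomial.aeval x G) : ∃ s, P.HasValue y s ∧ s ^ 2 = G.eval w := by
  obtain ⟨s, hs⟩ := IsAlgClosed.exists_pow_nat_eq (G.eval w) two_pos
  have h := hx.aeval G
  rw [HasValue, ← hy, ← hs, map_pow, sq_sub_sq, map_mul] at h
  by_contra! hne
  have h1 : 1 ≤ P.val (y - algebraMap ℂ K s) := not_lt.1 fun h' => hne s h' hs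
  have h2 : 1 ≤ P.val (y + algebraMap ℂ K s) := not_lt.1 fun h' =>
    hne (-s) (by simpa [HasValue] using h') (by rw [neg_sq, hs])
  -- The product (y + s)(y - s) = y² - s² lies in the maximal ideal, so one factor must.
  exact absurd h (not_lt.2 (one_le_mul h2 h1))

/-- Nonzero elements of a subring `A` of the local ring at `P` are powers of `τ` up to quotients of
elements of `A` that are units at `P`, when this holds for one step. -/
theorem exists_eq_pow_mul {A : Subalgebra ℂ K} (hA : ∀ b ∈ A, b ∈ P.ring) {τ : K}
    (hτ : P.val τ < 1)
    (hstep : ∀ b ∈ A, P.val b < 1 → ∃ q ∈ A, ∃ p ∈ A, P.val q = 1 ∧ b * q = τ * p)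
    (n : ℕ) : ∀ b ∈ A, WithZero.exp (-(n : ℤ)) ≤ P.val b →
      ∃ k : ℕ, ∃ q ∈ A, ∃ p ∈ A, P.val q = 1 ∧ P.val p = 1 ∧ b * q = τ ^ k * p := by
  induction n with
  | zero =>
    intro b hb h
    refine ⟨0, 1, A.one_mem, b, hb, map_one _, le_antisymm (P.val_le_one_iff.2 (hA b hb)) ?_,
      by ring⟩
    simpa using h
  | succ n ih =>
    intro b hb h
    rcases (P.val_le_one_iff.2 (hA b hb)).eq_or_lt with h1 | h1
    · exact ⟨0, 1, A.one_mem, b, hb, map_one _, h1, by ring⟩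
    obtain ⟨q, hq, p, hp, hq1, hbq⟩ := hstep b hb h1
    have hv : P.val b = P.val τ * P.val p := by
      rw [← map_mul, ← hbq, map_mul, hq1, mul_one]
    have hp' : WithZero.exp (-(n : ℤ)) ≤ P.val p := by
      have h2 : WithZero.exp (-1 : ℤ) * WithZero.exp (-(n : ℤ)) ≤
          WithZero.exp (-1 : ℤ) * P.val p := by
        -- Dividing by τ lowers the order by at least one, since τ has order at least one; this
        -- bounds the number of steps.
        rw [← WithZero.exp_add]
        refine le_trans (le_of_eq ?_) (h.trans (hv.le.trans (mul_le_mul_left (val_le_exp_neg_one hτ) _)))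
        congr 1; push_cast; ring
      exact le_of_mul_le_mul_left h2 (by simp [WithZero.exp_pos])
    obtain ⟨k, q', hq', p', hp'', h3, h4, h5⟩ := ih p hp hp'
    refine ⟨k + 1, q * q', A.mul_mem hq hq', p', hp'', by rw [map_mul, hq1, h3, one_mul], h4, ?_⟩
    rw [← mul_assoc, hbq, mul_assoc, h5]; ring

theorem exists_eq_zpow_mul {A : Subalgebra ℂ K} (hA : ∀ b ∈ A, b ∈ P.ring)
    (hfrac : ∀ z : K, ∃ a ∈ A, ∃ b ∈ A, z = a / b) {τ : K} (hτ0 : τ ≠ 0)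
    (hτ : P.val τ < 1)
    (hstep : ∀ b ∈ A, P.val b < 1 → ∃ q ∈ A, ∃ p ∈ A, P.val q = 1 ∧ b * q = τ * p)
    {z : K} (hz : z ≠ 0) :
    ∃ k : ℤ, ∃ p ∈ A, ∃ q ∈ A, P.val p = 1 ∧ P.val q = 1 ∧ z = τ ^ k * (p / q) := by
  have key : ∀ b ∈ A, b ≠ 0 →
      ∃ k : ℕ, ∃ q ∈ A, ∃ p ∈ A, P.val q = 1 ∧ P.val p = 1 ∧ b * q = τ ^ k * p := by
    intro b hb hb0
    have h0 : P.val b ≠ 0 := (Valuation.ne_zero_iff _).2 hb0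
    refine exists_eq_pow_mul hA hτ hstep (-WithZero.log (P.val b)).toNat b hb ?_
    conv_rhs => rw [← WithZero.exp_log h0]
    rw [WithZero.exp_le_exp]
    omega
  obtain ⟨a, ha, b, hb, rfl⟩ := hfrac z
  obtain ⟨ha0, hb0⟩ := div_ne_zero_iff.1 hz
  obtain ⟨k, q, hq, p, hp, hq1, hp1, h1⟩ := key a ha ha0
  obtain ⟨l, q', hq', p', hp', hq1', hp1', h1'⟩ := key b hb hb0
  refine ⟨k - l, p * q', A.mul_mem hp hq', q * p', A.mul_mem hq hp', by simp [hp1, hq1'],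
    by simp [hq1, hp1'], ?_⟩
  have e1 : q ≠ 0 := fun h => by simp [h] at hq1
  have e2 : q' ≠ 0 := fun h => by simp [h] at hq1'
  have e3 : p' ≠ 0 := fun h => by simp [h] at hp1'
  rw [zpow_sub₀ hτ0, zpow_natCast, zpow_natCast]
  field_simp
  linear_combination (τ ^ l * p') * h1 - τ ^ k * p * h1'

/-- The data `(x - a) q = τ p_x`, `(y - b) q = τ p_y` identify a local parameter `τ` at `P`, and
derivations that do not lower the order of the generators `x`, `y` behave at `P` as if they were
multiples of `d/dτ`. -/
theorem val_derivation {x y τ q px py : K} {a b : ℂ}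
    (hgen : IntermediateField.adjoin ℂ {x, y} = ⊤) (hx : x ∈ P.ring) (hy : y ∈ P.ring)
    (hτ0 : τ ≠ 0) (hτ : P.val τ < 1) (hqA : q ∈ Algebra.adjoin ℂ {x, y})
    (hpx : px ∈ Algebra.adjoin ℂ {x, y}) (hpy : py ∈ Algebra.adjoin ℂ {x, y})
    (hq : P.val q = 1) (hxa : (x - algebraMap ℂ K a) * q = τ * px)
    (hyb : (y - algebraMap ℂ K b) * q = τ * py) (δ : Derivation ℂ K K)
    (hδx : P.val (δ x) ≤ P.val (δ τ)) (hδy : P.val (δ y) ≤ P.val (δ τ)) (hδ : δ τ ≠ 0) :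
    P.val τ = WithZero.exp (-1 : ℤ) ∧ P.val (δ P.parameter) = P.val (δ τ) := by
  set A := Algebra.adjoin ℂ ({x, y} : Set K) with hAdef
  have hA : ∀ b ∈ A, b ∈ P.ring := by
    intro b hb
    induction hb using Algebra.adjoin_induction with
    | mem z hz => rcases hz with rfl | rfl <;> assumption
    | algebraMap r => exact P.algebraMap_mem r
    | add _ _ _ _ h h' => exact P.ring.add_mem _ _ h h'
    | mul _ _ _ _ h h' => exact P.ring.mul_mem _ _ h h'
  -- The same q serves for all of A, because uv - cc' = u(v - c') + c'(u - c).
  have hval : ∀ z ∈ A, ∃ c : ℂ, ∃ p ∈ A, (z - algebraMap ℂ K c) * q = τ * p := by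
    intro z hz
    induction hz using Algebra.adjoin_induction with
    | mem z hz =>
      rcases hz with rfl | rfl
      exacts [⟨a, px, hpx, hxa⟩, ⟨b, py, hpy, hyb⟩]
    | algebraMap r => exact ⟨r, 0, A.zero_mem, by simp⟩
    | add u v _ _ h h' =>
      obtain ⟨c, p, hp, e⟩ := h
      obtain ⟨c', p', hp', e'⟩ := h'
      refine ⟨c + c', p + p', A.add_mem hp hp', ?_⟩
      rw [map_add]; linear_combination e + e'
    | mul u v hu hv h h' =>
      obtain ⟨c, p, hp, e⟩ := h
      obtain ⟨c', p', hp', e'⟩ := h'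
      refine ⟨c * c', u * p' + algebraMap ℂ K c' * p,
        A.add_mem (A.mul_mem hu hp') (A.mul_mem (A.algebraMap_mem _) hp), ?_⟩
      rw [map_mul]; linear_combination u * e' + algebraMap ℂ K c' * e
  have hstep : ∀ b ∈ A, P.val b < 1 → ∃ q ∈ A, ∃ p ∈ A, P.val q = 1 ∧ b * q = τ * p := by
    intro z hz h1
    obtain ⟨c, p, hp, e⟩ := hval z hz
    have hc : P.val (z - algebraMap ℂ K c) < 1 := by
      have := congrArg P.val e
      rw [map_mul, hq, mul_one, map_mul] at this
      rw [this]
      exact mul_lt_one_of_lt_of_le hτ (P.val_le_one_iff.2 (hA p hp))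
    have hz0 : P.HasValue z 0 := by simpa [HasValue] using h1
    obtain rfl : c = 0 := HasValue.unique hc hz0
    exact ⟨q, hqA, p, hp, hq, by simpa using e⟩
  have hfrac : ∀ z : K, ∃ a ∈ A, ∃ b ∈ A, z = a / b := fun z => by
    have : z ∈ IntermediateField.adjoin ℂ {x, y} := hgen ▸ IntermediateField.mem_top
    obtain ⟨r, hr, s, hs, h⟩ := IntermediateField.mem_adjoin_iff_div.1 this
    exact ⟨r, hr, s, hs, h⟩
  have hδA : ∀ z ∈ A, P.val (δ z) ≤ P.val (δ τ) := by
    intro z hz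
    induction hz using Algebra.adjoin_induction with
    | mem z hz => rcases hz with rfl | rfl <;> assumption
    | algebraMap r => simp
    | add u v _ _ h h' =>
      rw [map_add]
      exact Valuation.map_add_le _ h h'
    | mul u v hu hv h h' =>
      rw [Derivation.leibniz, smul_eq_mul, smul_eq_mul]
      refine Valuation.map_add_le _ ?_ ?_
      · rw [map_mul]
        exact mul_le_of_le_one_of_le (P.val_le_one_iff.2 (hA u hu)) h'
      · rw [map_mul]
        exact mul_le_of_le_one_of_le (P.val_le_one_iff.2 (hA v hv)) h
  have ht0 : P.parameter ≠ 0 := fun h => by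
    have := P.val_parameter
    rw [h, map_zero] at this
    exact WithZero.exp_ne_zero this.symm
  obtain ⟨k, p, hp, r, hr, hp1, hr1, ht⟩ := exists_eq_zpow_mul hA hfrac hτ0 hτ hstep ht0
  have hvτ0 : P.val τ ≠ 0 := (Valuation.ne_zero_iff _).2 hτ0
  -- The parameter t has order exactly 1 and equals τ^k times a unit; as τ has positive order, k =
  -- 1.
  have hk : k * WithZero.log (P.val τ) = -1 := by
    have h := congrArg (fun z => WithZero.log (P.val z)) ht
    simp only [P.val_parameter, map_mul, map_div₀, hp1, hr1, div_one, mul_one, map_zpow₀,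
      WithZero.log_exp, WithZero.log_zpow, smul_eq_mul] at h
    exact h.symm
  have hlog : WithZero.log (P.val τ) < 0 := by
    rw [← WithZero.exp_log hvτ0, ← WithZero.exp_zero, WithZero.exp_lt_exp] at hτ
    exact hτ
  have hk1 : k = 1 := by
    rcases Int.eq_one_or_neg_one_of_mul_eq_neg_one hk with rfl | rfl <;> omega
  subst hk1
  rw [zpow_one] at ht
  have hv : P.val τ = WithZero.exp (-1 : ℤ) := by
    rw [← P.val_parameter, ht, map_mul, map_div₀, hp1, hr1, div_one, mul_one]
  refine ⟨hv, ?_⟩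
  have hr0 : r ≠ 0 := fun h => by simp [h] at hr1
  -- Differentiate t r = τ p. The terms other than p δτ carry a factor τ or t, hence are strictly
  -- smaller than δτ.
  have e : δ P.parameter = (δ τ * p + (τ * δ p - P.parameter * δ r)) / r := by
    have h1 : P.parameter * r = τ * p := by rw [ht]; field_simp
    have h2 := congrArg δ h1
    simp only [Derivation.leibniz, smul_eq_mul] at h2
    rw [eq_div_iff hr0]
    linear_combination h2
  have small : P.val (τ * δ p - P.parameter * δ r) < P.val (δ τ) := by
    have hpos : 0 < P.val (δ τ) := zero_lt_iff.2 ((Valuation.ne_zero_iff _).2 hδ)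
    have hlt1 : WithZero.exp (-1 : ℤ) < (1 : ℤᵐ⁰) := by
      rw [← WithZero.exp_zero, WithZero.exp_lt_exp]; norm_num
    refine Valuation.map_sub_lt _ ?_ ?_
    · rw [map_mul, hv]
      exact (mul_le_mul_right (hδA p hp) _).trans_lt (mul_lt_of_lt_one_left hpos hlt1)
    · rw [map_mul, P.val_parameter]
      exact (mul_le_mul_right (hδA r hr) _).trans_lt (mul_lt_of_lt_one_left hpos hlt1)
  have hmain : P.val (δ τ * p) = P.val (δ τ) := by rw [map_mul, hp1, mul_one]
  rw [e, map_div₀, hr1, div_one, Valuation.map_add_eq_of_lt_left _ (hmain.symm ▸ small), hmain]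

end Point

/-! ### Kähler differentials and their tensor powers -/

section Differentials

variable {K : Type*} [Field K] [Algebra ℂ K]

/-- Once `Ω` is identified with `K`, so is its `q`-th tensor power. -/
def qDiffEquiv (e : Ω[K⁄ℂ] ≃ₗ[K] K) (q : ℕ) : QDiff K q ≃ₗ[K] K :=
  (PiTensorProduct.congr fun _ => e) ≪≫ₗ
    (PiTensorProduct.constantBaseRingEquiv (Fin q) K).toLinearEquiv

theorem qDiffEquiv_dPow (e : Ω[K⁄ℂ] ≃ₗ[K] K) (q : ℕ) (z : K) :
    qDiffEquiv e q (dPow q z) = e (KaehlerDifferential.D ℂ K z) ^ q := by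
  rw [qDiffEquiv, dPow, LinearEquiv.trans_apply, PiTensorProduct.congr_tprod]
  simp

/-- A field `K`, finite separable over the rational functions in `x`, has `Ω` free on `dx`. -/
theorem exists_kaehlerEquiv [Algebra ℂ[X] K] [IsScalarTower ℂ ℂ[X] K] [Algebra (RatFunc ℂ) K]
    [IsScalarTower ℂ[X] (RatFunc ℂ) K] [Algebra.IsAlgebraic (RatFunc ℂ) K] :
    ∃ e : Ω[K⁄ℂ] ≃ₗ[K] K, e (KaehlerDifferential.D ℂ K (algebraMap ℂ[X] K X)) = 1 := by
  -- A localization followed by a separable algebraic extension (characteristic 0) is formally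
  -- étale, so Ω of K is the base change of Ω of ℂ[X], which is free on dX.
  have h1 : Algebra.FormallyEtale ℂ[X] (RatFunc ℂ) :=
    Algebra.FormallyEtale.of_isLocalization (nonZeroDivisors ℂ[X])
  have h2 : Algebra.FormallyEtale (RatFunc ℂ) K := Algebra.FormallyEtale.of_isSeparable _ _
  have h3 : Algebra.FormallyEtale ℂ[X] K := Algebra.FormallyEtale.comp _ (RatFunc ℂ) _
  refine ⟨(KaehlerDifferential.tensorKaehlerEquivOfFormallyEtale ℂ ℂ[X] K).symm ≪≫ₗ
    TensorProduct.AlgebraTensorModule.congr (LinearEquiv.refl K K)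
      (KaehlerDifferential.polynomialEquiv ℂ) ≪≫ₗ TensorProduct.AlgebraTensorModule.rid _ _ _, ?_⟩
  rw [LinearEquiv.trans_apply, LinearEquiv.trans_apply,
    KaehlerDifferential.tensorKaehlerEquivOfFormallyEtale_symm_D_algebraMap]
  simp [KaehlerDifferential.polynomialEquiv_D]

end Differentials

/-! ### The function field ℂ(x, y) and the derivation d/dx -/

namespace Octic

variable (C : Octic)

instance : FiniteDimensional (RatFunc ℂ) C.FunctionField :=
  (monic_X_pow_sub_C _ two_ne_zero).finite_adjoinRoot

theorem algebraMap_X : algebraMap ℂ[X] C.FunctionField X = C.x := by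
  rw [IsScalarTower.algebraMap_apply ℂ[X] (RatFunc ℂ), RatFunc.algebraMap_X, x]

theorem algebraMap_eq_aeval (p : ℂ[X]) : algebraMap ℂ[X] C.FunctionField p = aeval C.x p := by
  rw [← algebraMap_X, aeval_algebraMap_apply, aeval_X_left_apply]

theorem aeval_x_injective : Function.Injective (aeval C.x : ℂ[X] → C.FunctionField) := by
  intro p q h
  rw [← algebraMap_eq_aeval, ← algebraMap_eq_aeval] at h
  rw [IsScalarTower.algebraMap_apply ℂ[X] (RatFunc ℂ) C.FunctionField p,
    IsScalarTower.algebraMap_apply ℂ[X] (RatFunc ℂ) C.FunctionField q] at h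
  exact IsFractionRing.injective ℂ[X] (RatFunc ℂ) ((algebraMap (RatFunc ℂ) _).injective h)

theorem y_sq' : C.y ^ 2 = algebraMap (RatFunc ℂ) C.FunctionField (algebraMap ℂ[X] _ C.g) := by
  rw [y_sq, ← algebraMap_eq_aeval, IsScalarTower.algebraMap_apply ℂ[X] (RatFunc ℂ)]

theorem g_ne_zero : C.g ≠ 0 := C.separable.ne_zero

theorem y_ne_zero : C.y ≠ 0 := fun h => by
  have h1 := C.y_sq
  rw [h, zero_pow two_ne_zero, ← map_zero (aeval C.x : ℂ[X] →ₐ[ℂ] C.FunctionField)] at h1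
  exact C.g_ne_zero (C.aeval_x_injective h1).symm

theorem x_ne_zero : C.x ≠ 0 := fun h => by
  have h1 : aeval C.x (X : ℂ[X]) = aeval C.x (0 : ℂ[X]) := by simpa using h
  exact X_ne_zero (C.aeval_x_injective h1)

theorem exists_eq_add_mul_y (z : C.FunctionField) :
    ∃ a b : RatFunc ℂ, z = algebraMap _ _ a + algebraMap _ _ b * C.y := by
  induction z using AdjoinRoot.induction_on with
  | ih p =>
    induction p using Polynomial.induction_on with
    | C a => exact ⟨a, 0, by simp⟩
    | add p q hp hq =>
      obtain ⟨a, b, h⟩ := hp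
      obtain ⟨c, d, h'⟩ := hq
      exact ⟨a + c, b + d, by rw [map_add, h, h', map_add, map_add]; ring⟩
    | monomial n r h =>
      obtain ⟨a, b, h⟩ := h
      refine ⟨b * algebraMap ℂ[X] _ C.g, a, ?_⟩
      have h1 : AdjoinRoot.mk C.equation X = C.y := AdjoinRoot.mk_X
      rw [pow_succ, ← mul_assoc, map_mul, h, h1, map_mul, ← C.y_sq']
      ring

theorem adjoin_x_y : IntermediateField.adjoin ℂ {C.x, C.y} = ⊤ := by
  rw [eq_top_iff]
  rintro z -
  have hx : C.x ∈ IntermediateField.adjoin ℂ {C.x, C.y} :=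
    IntermediateField.subset_adjoin _ _ (by simp)
  have hy : C.y ∈ IntermediateField.adjoin ℂ {C.x, C.y} :=
    IntermediateField.subset_adjoin _ _ (by simp)
  have hp (p : ℂ[X]) : aeval C.x p ∈ IntermediateField.adjoin ℂ {C.x, C.y} :=
    Algebra.adjoin_le (S := (IntermediateField.adjoin ℂ {C.x, C.y}).toSubalgebra)
      (Set.singleton_subset_iff.2 hx) (aeval_mem_adjoin_singleton ℂ C.x)
  have hr (r : RatFunc ℂ) : algebraMap _ C.FunctionField r ∈
      IntermediateField.adjoin ℂ {C.x, C.y} := by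
    obtain ⟨p, q, -, rfl⟩ := IsFractionRing.div_surjective ℂ[X] r
    rw [map_div₀, ← IsScalarTower.algebraMap_apply, ← IsScalarTower.algebraMap_apply,
      algebraMap_eq_aeval, algebraMap_eq_aeval]
    exact div_mem (hp p) (hp q)
  obtain ⟨a, b, rfl⟩ := C.exists_eq_add_mul_y z
  exact add_mem (hr a) (mul_mem (hr b) hy)

/-- The identification of differentials `h dx` with functions `h`. -/
def kaehlerEquiv : Ω[C.FunctionField⁄ℂ] ≃ₗ[C.FunctionField] C.FunctionField :=
  (exists_kaehlerEquiv (K := C.FunctionField)).choose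

/-- The derivation `d/dx`. -/
def deriv : Derivation ℂ C.FunctionField C.FunctionField :=
  C.kaehlerEquiv.toLinearMap.compDer (KaehlerDifferential.D ℂ C.FunctionField)

theorem deriv_x : C.deriv C.x = 1 := by
  rw [← algebraMap_X]
  exact (exists_kaehlerEquiv (K := C.FunctionField)).choose_spec

/-- The identification of `2`-differentials `h (dx)²` with functions `h`. -/
def quadEquiv : QDiff C.FunctionField 2 ≃ₗ[C.FunctionField] C.FunctionField :=
  qDiffEquiv C.kaehlerEquiv 2

theorem quadEquiv_dPow (z : C.FunctionField) : C.quadEquiv (dPow 2 z) = C.deriv z ^ 2 :=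
  qDiffEquiv_dPow _ _ _

end Octic

/-! ### The divisor of dx/y and the holomorphy criterion -/

namespace Octic

variable {C : Octic} {P : Point C.FunctionField}

/-- If x were regular without a value, every x - a would be a unit. As ℂ is algebraically closed,
all nonzero polynomials in x would be units, so ℂ(x), then y, then the whole field would lie in the
local ring; but 1/t does not. -/
theorem mem_ring_iff_exists_hasValue : C.x ∈ P.ring ↔ ∃ w, P.HasValue C.x w := by
  refine ⟨fun hx => ?_, fun ⟨w, hw⟩ => hw.mem⟩
  by_contra! hne
  have hlin (w : ℂ) : P.val (C.x - algebraMap ℂ _ w) = 1 :=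
    le_antisymm (P.val_le_one_iff.2 (P.ring.sub_mem hx (P.algebraMap_mem w))) (not_lt.1 (hne w))
  have hpoly (p : ℂ[X]) (hp : p ≠ 0) : P.val (aeval C.x p) = 1 := by
    rw [(IsAlgClosed.splits p).eq_prod_roots, map_mul, map_mul, aeval_C,
      P.val_algebraMap (leadingCoeff_ne_zero.2 hp), one_mul, map_multiset_prod, map_multiset_prod]
    refine Multiset.prod_eq_one fun z hz => ?_
    simp only [Multiset.map_map, Multiset.mem_map] at hz
    obtain ⟨a, -, rfl⟩ := hz
    simpa using hlin a
  have hrat (r : RatFunc ℂ) : algebraMap _ C.FunctionField r ∈ P.ring := by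
    rcases eq_or_ne r 0 with rfl | hr
    · rw [map_zero]; exact P.ring.zero_mem
    obtain ⟨p, q, hq, rfl⟩ := IsFractionRing.div_surjective ℂ[X] r
    have hp : p ≠ 0 := by rintro rfl; simp at hr
    rw [← P.val_le_one_iff, map_div₀, ← IsScalarTower.algebraMap_apply,
      ← IsScalarTower.algebraMap_apply, algebraMap_eq_aeval, algebraMap_eq_aeval, map_div₀,
      hpoly p hp, hpoly q (nonZeroDivisors.ne_zero hq), div_one]
  have hy : C.y ∈ P.ring := by
    rw [← P.val_le_one_iff, ← pow_le_one_iff two_ne_zero, ← map_pow, C.y_sq,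
      hpoly _ C.g_ne_zero]
  obtain ⟨a, b, h⟩ := C.exists_eq_add_mul_y P.parameter⁻¹
  have h1 : P.parameter⁻¹ ∈ P.ring := h ▸ P.ring.add_mem _ _ (hrat a) (P.ring.mul_mem _ _ (hrat b) hy)
  rw [← P.val_le_one_iff, map_inv₀, P.val_parameter, ← WithZero.exp_neg, ← WithZero.exp_zero,
    WithZero.exp_le_exp] at h1
  norm_num at h1

/-- Differentiating the factorization identifies H(w). At a branch point this makes H(x) a unit,
because the zero of G is simple. -/
theorem exists_sub_eval_eq (G : ℂ[X]) (w : ℂ) :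
    ∃ H : ℂ[X], G - Polynomial.C (G.eval w) = (X - Polynomial.C w) * H ∧
      H.eval w = (derivative G).eval w := by
  obtain ⟨H, hH⟩ := X_sub_C_dvd_sub_C_eval (p := G) (a := w)
  refine ⟨H, hH, ?_⟩
  have h := congrArg (fun p => (derivative p).eval w) hH
  simpa using h.symm

theorem aeval_mem_adjoin {K : Type*} [Field K] [Algebra ℂ K] (x y : K) (p : ℂ[X]) :
    aeval x p ∈ Algebra.adjoin ℂ {x, y} :=
  Algebra.adjoin_mono (by simp) (aeval_mem_adjoin_singleton ℂ x)

/-- At a point of `y² = G(x)` with `y ≠ 0`, the function `x - w` is a local parameter. -/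
theorem val_derivation_of_ne_zero {K : Type*} [Field K] [Algebra ℂ K] {P : Point K} {x y : K}
    {G : ℂ[X]} (hgen : IntermediateField.adjoin ℂ {x, y} = ⊤) (hxy : y ^ 2 = aeval x G)
    {w s : ℂ} (hx : P.HasValue x w) (hy : P.HasValue y s) (hs : s ≠ 0)
    (hxw : x - algebraMap ℂ K w ≠ 0) (δ : Derivation ℂ K K) (hδ : δ x ≠ 0) :
    P.val (x - algebraMap ℂ K w) = WithZero.exp (-1 : ℤ) ∧
      P.val (δ P.parameter) = P.val (δ x) := by
  have hsq : s ^ 2 = G.eval w := by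
    have h := hx.aeval G
    rw [← hxy, sq] at h
    rw [sq, (hy.mul hy).unique h]
  obtain ⟨H, hH, -⟩ := exists_sub_eval_eq G w
  have hH' : y ^ 2 - algebraMap ℂ K s ^ 2 = (x - algebraMap ℂ K w) * aeval x H := by
    have h := congrArg (aeval x) hH
    simpa [← hsq, hxy] using h
  have hys : P.HasValue (y + algebraMap ℂ K s) (s + s) := hy.add (Point.hasValue_algebraMap s)
  have hyA : y ∈ Algebra.adjoin ℂ {x, y} := Algebra.subset_adjoin (by simp)
  have hqA : y + algebraMap ℂ K s ∈ Algebra.adjoin ℂ {x, y} :=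
    add_mem hyA (Subalgebra.algebraMap_mem _ _)
  have hδτ : δ (x - algebraMap ℂ K w) = δ x := by simp
  have hδy : P.val (δ y) ≤ P.val (δ x) := by
    have h := congrArg δ hxy
    rw [Derivation.leibniz_pow, Derivation.map_aeval] at h
    have h2 := (hx.aeval (derivative G)).mem
    have h3 : P.val (2 * y) = 1 := by
      rw [← map_ofNat (algebraMap ℂ K) 2, map_mul, P.val_algebraMap two_ne_zero,
        hy.val_eq_one hs, one_mul]
    have h4 : (2 * y) * δ y = aeval x (derivative G) * δ x := by simpa [mul_assoc] using h
    have h5 := congrArg P.val h4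
    rw [map_mul, h3, one_mul, map_mul] at h5
    rw [h5]
    exact mul_le_of_le_one_left' (P.val_le_one_iff.2 h2)
  rw [← hδτ] at hδ hδy ⊢
  -- Here τ = x - w and q = y + s, a unit with value 2s; the relation for y is (y - s)(y + s) = (x -
  -- w) H(x).
  exact Point.val_derivation (b := s) hgen hx.mem hy.mem hxw hx hqA hqA (aeval_mem_adjoin x y H)
    (hys.val_eq_one (by rw [← two_mul]; exact mul_ne_zero two_ne_zero hs)) rfl
    (by rw [← hH']; ring) δ (congrArg P.val hδτ).ge hδy hδ

/-- At a point of `y² = G(x)` with `y = 0`, where `G` has a simple zero, the function `y` is a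
local parameter. -/
theorem val_derivation_of_eq_zero {K : Type*} [Field K] [Algebra ℂ K] {P : Point K} {x y : K}
    {G : ℂ[X]} (hgen : IntermediateField.adjoin ℂ {x, y} = ⊤) (hxy : y ^ 2 = aeval x G)
    {w : ℂ} (hx : P.HasValue x w) (hy : P.HasValue y 0) (hG : (derivative G).eval w ≠ 0)
    (hy0 : y ≠ 0) (δ : Derivation ℂ K K) (hδ : δ x ≠ 0) :
    P.val (y * δ P.parameter) = P.val (δ x) := by
  have hsq : G.eval w = 0 := by
    have h := hx.aeval G
    rw [← hxy, sq] at h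
    rw [h.unique (hy.mul hy), mul_zero]
  obtain ⟨H, hH, hHw⟩ := exists_sub_eval_eq G w
  have hH' : y ^ 2 = (x - algebraMap ℂ K w) * aeval x H := by
    have h := congrArg (aeval x) hH
    simpa [hsq, hxy] using h
  have hyδ : P.val (y * δ y) = P.val (δ x) := by
    have h := congrArg δ hxy
    rw [Derivation.leibniz_pow, Derivation.map_aeval] at h
    have h4 : 2 * (y * δ y) = aeval x (derivative G) * δ x := by simpa [mul_assoc] using h
    rw [← map_ofNat (algebraMap ℂ K) 2] at h4
    have h5 := congrArg P.val h4
    rwa [map_mul, map_mul _ (aeval x _), P.val_algebraMap two_ne_zero,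
      (hx.aeval _).val_eq_one hG, one_mul, one_mul] at h5
  have hδy : δ y ≠ 0 := fun h => by
    rw [h, mul_zero, map_zero] at hyδ
    exact hδ ((Valuation.zero_iff _).1 hyδ.symm)
  have hlt : P.val y < 1 := by simpa [Point.HasValue] using hy
  -- Here τ = y and q = H(x); the relation for x is (x - w) H(x) = y · y, and the one for y is
  -- trivial.
  have h := (Point.val_derivation (q := aeval x H) hgen hx.mem hy.mem hy0 hlt
    (aeval_mem_adjoin x y H)
    (px := y) (py := aeval x H) (a := w) (b := 0) (Algebra.subset_adjoin (by simp))
    (aeval_mem_adjoin x y H) ((hx.aeval H).val_eq_one (hHw ▸ hG)) (by rw [← hH', sq]) (by simp)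
    δ ?_ le_rfl hδy).2
  · rw [map_mul, h, ← map_mul, hyδ]
  · rw [← hyδ, map_mul]
    exact mul_le_of_le_one_left' hlt.le

theorem x_sub_ne_zero (w : ℂ) : C.x - algebraMap ℂ _ w ≠ 0 := fun h => by
  have h1 : aeval C.x (X - Polynomial.C w) = aeval C.x (0 : ℂ[X]) := by simpa using h
  exact X_sub_C_ne_zero w (C.aeval_x_injective h1)

theorem deriv_x_ne_zero : C.deriv C.x ≠ 0 := by
  rw [deriv_x]; exact one_ne_zero

/-- At finite points `dx / y` has neither a zero nor a pole. -/
theorem val_y_mul_deriv_parameter (hx : C.x ∈ P.ring) :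
    P.val (C.y * C.deriv P.parameter) = 1 := by
  obtain ⟨w, hw⟩ := mem_ring_iff_exists_hasValue.1 hx
  obtain ⟨s, hs, hsq⟩ := hw.exists_of_sq C.y_sq
  rcases eq_or_ne s 0 with rfl | hs0
  · rw [val_derivation_of_eq_zero C.adjoin_x_y C.y_sq hw hs ?_ C.y_ne_zero C.deriv C.deriv_x_ne_zero,
      deriv_x, map_one]
    refine (C.separable.aeval_derivative_ne_zero (x := w) ?_)
    simpa using hsq.symm
  · rw [map_mul, (val_derivation_of_ne_zero C.adjoin_x_y C.y_sq hw hs hs0 (x_sub_ne_zero w) C.deriv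
      C.deriv_x_ne_zero).2, deriv_x, map_one, mul_one, hs.val_eq_one hs0]

/-- The chart at infinity has again the form v² = G(u), with u = 1/x and v = y/x⁴. As the degree is
exactly 8, G(0) is the leading coefficient of g, so v ≠ 0 where u = 0 and the unbranched case
applies there. -/
theorem y_div_sq : (C.y / C.x ^ 4) ^ 2 = aeval C.x⁻¹ C.g.reverse := by
  let := invertibleOfNonzero C.x_ne_zero
  have h := eval₂_reverse_mul_pow (algebraMap ℂ C.FunctionField) C.x C.g
  rw [C.natDegree_eq, ← aeval_def, ← aeval_def, ← C.y_sq, invOf_eq_inv] at h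
  have := C.x_ne_zero
  rw [div_pow, ← h]
  field_simp

theorem adjoin_inv_x : IntermediateField.adjoin ℂ {C.x⁻¹, C.y / C.x ^ 4} = ⊤ := by
  rw [← C.adjoin_x_y]
  refine le_antisymm (C.adjoin_x_y ▸ le_top) (IntermediateField.adjoin_le_iff.2 ?_)
  have hx : C.x ∈ IntermediateField.adjoin ℂ {C.x⁻¹, C.y / C.x ^ 4} := by
    rw [← inv_inv C.x]
    exact inv_mem (IntermediateField.subset_adjoin _ _ (by simp))
  rintro z (rfl | rfl)
  · exact hx
  · have hy : C.y / C.x ^ 4 ∈ IntermediateField.adjoin ℂ {C.x⁻¹, C.y / C.x ^ 4} :=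
      IntermediateField.subset_adjoin _ _ (by simp)
    simpa [C.x_ne_zero] using mul_mem hy (pow_mem hx 4)

theorem val_inv_x_lt (hx : C.x ∉ P.ring) : P.val C.x⁻¹ < 1 := by
  rw [← P.val_le_one_iff, not_le] at hx
  rw [map_inv₀]
  exact inv_lt_one_of_one_lt₀ hx

/-- The order of `dx / y` at the points at infinity. -/
theorem val_y_mul_deriv_parameter_of_notMem (hx : C.x ∉ P.ring) :
    P.val (C.y * C.deriv P.parameter) = P.val C.x ^ 2 := by
  have hw : P.HasValue C.x⁻¹ 0 := by simpa [Point.HasValue] using val_inv_x_lt hx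
  obtain ⟨s, hs, hsq⟩ := hw.exists_of_sq C.y_div_sq
  have hs0 : s ≠ 0 := by
    rintro rfl
    rw [← coeff_zero_eq_eval_zero, coeff_zero_reverse, zero_pow two_ne_zero] at hsq
    exact leadingCoeff_ne_zero.2 C.g_ne_zero hsq.symm
  have hd : C.deriv C.x⁻¹ = -(C.x⁻¹ ^ 2) := by
    rw [Derivation.leibniz_inv, deriv_x]; simp
  have h := (val_derivation_of_ne_zero C.adjoin_inv_x C.y_div_sq hw hs hs0
    (by simpa using C.x_ne_zero) C.deriv (by rw [hd]; simpa using C.x_ne_zero)).2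
  have hy := hs.val_eq_one hs0
  have hx0 : P.val C.x ≠ 0 := (Valuation.ne_zero_iff _).2 C.x_ne_zero
  rw [map_div₀, map_pow, div_eq_one_iff_eq (pow_ne_zero 4 hx0)] at hy
  rw [map_mul, h, hy, hd, Valuation.map_neg, map_pow, map_inv₀]
  field_simp

theorem deriv_parameter_ne_zero (P : Point C.FunctionField) : C.deriv P.parameter ≠ 0 := by
  intro h
  by_cases hx : C.x ∈ P.ring
  · have := val_y_mul_deriv_parameter hx
    simp [h] at this
  · have := val_y_mul_deriv_parameter_of_notMem hx
    rw [h, mul_zero, map_zero] at this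
    exact pow_ne_zero 2 ((Valuation.ne_zero_iff _).2 C.x_ne_zero) this.symm

variable (C) in
/-- The identification of `2`-differentials `F (dx)² / y²` with functions `F`. -/
def quadCoord : QDiff C.FunctionField 2 ≃ₗ[C.FunctionField] C.FunctionField :=
  C.quadEquiv ≪≫ₗ LinearEquiv.smulOfNeZero _ _ (C.y ^ 2) (pow_ne_zero 2 C.y_ne_zero)

theorem quadCoord_smul_dPow (F z : C.FunctionField) :
    C.quadCoord (F • dPow 2 z) = F * (C.y * C.deriv z) ^ 2 := by
  rw [map_smul, quadCoord, LinearEquiv.trans_apply, quadEquiv_dPow,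
    LinearEquiv.smulOfNeZero_apply, smul_eq_mul, smul_eq_mul, mul_pow]

/-- In the coordinate F of F (dx)²/y², the differential (dt)² becomes (y dt/dx)² ≠ 0. So the
coefficient of (dt)² exists and is unique, which pins down the choice made in `Point.coeff`. -/
theorem eq_smul_dPow_iff {ω : QDiff C.FunctionField 2} {h : C.FunctionField} :
    ω = h • dPow 2 P.parameter ↔ h = C.quadCoord ω / (C.y * C.deriv P.parameter) ^ 2 := by
  rw [← C.quadCoord.injective.eq_iff, quadCoord_smul_dPow, eq_div_iff, eq_comm]
  exact pow_ne_zero 2 (mul_ne_zero C.y_ne_zero (deriv_parameter_ne_zero P))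

theorem holomorphicAt_iff {ω : QDiff C.FunctionField 2} :
    P.HolomorphicAt ω ↔ P.val (C.quadCoord ω) ≤ P.val (C.y * C.deriv P.parameter) ^ 2 := by
  have h0 : 0 < P.val (C.y * C.deriv P.parameter) ^ 2 :=
    zero_lt_iff.2 (pow_ne_zero 2 ((Valuation.ne_zero_iff _).2
      (mul_ne_zero C.y_ne_zero (deriv_parameter_ne_zero P))))
  rw [← div_le_one₀ h0, ← map_pow, ← map_div₀, P.val_le_one_iff]
  simp [Point.HolomorphicAt, eq_smul_dPow_iff]

theorem coeff_eq (ω : QDiff C.FunctionField 2) :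
    P.coeff ω = C.quadCoord ω / (C.y * C.deriv P.parameter) ^ 2 :=
  eq_smul_dPow_iff.1 (Classical.epsilon_spec (p := fun h => ω = h • dPow 2 P.parameter)
    ⟨_, eq_smul_dPow_iff.2 rfl⟩)

theorem qOrd_eq (hx : C.x ∈ P.ring) (ω : QDiff C.FunctionField 2) :
    P.qOrd ω = P.ord (C.quadCoord ω) := by
  rw [Point.qOrd, coeff_eq, Point.ord, Point.ord, map_div₀, map_pow, val_y_mul_deriv_parameter hx,
    one_pow, div_one]

theorem mem_H0_iff {ω : QDiff C.FunctionField 2} :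
    ω ∈ H0 C.FunctionField 2 ↔
      (∀ P : Point C.FunctionField, C.x ∈ P.ring → C.quadCoord ω ∈ P.ring) ∧
      ∀ P : Point C.FunctionField, C.x ∉ P.ring → C.quadCoord ω / C.x ^ 4 ∈ P.ring := by
  have h : ω ∈ H0 C.FunctionField 2 ↔ ∀ P : Point C.FunctionField, P.HolomorphicAt ω := Iff.rfl
  rw [h, ← forall_and]
  refine forall_congr' fun P => ?_
  rw [holomorphicAt_iff]
  by_cases hx : C.x ∈ P.ring
  · simp [hx, val_y_mul_deriv_parameter hx, P.val_le_one_iff]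
  · have h0 : 0 < P.val (C.x ^ 4) :=
      zero_lt_iff.2 ((Valuation.ne_zero_iff _).2 (pow_ne_zero 4 C.x_ne_zero))
    simp only [hx, false_imp_iff, true_and, not_false_eq_true, true_imp_iff]
    rw [val_y_mul_deriv_parameter_of_notMem hx, ← P.val_le_one_iff, map_div₀, div_le_one₀ h0,
      map_pow, ← pow_mul]

end Octic

/-! ### Regularity and integrality over ℂ[u] -/

section Integrality

/-- The point of a nonzero prime of a Dedekind domain of constants and functions. -/
def pointOfHeightOne {K B : Type*} [Field K] [Algebra ℂ K] [CommRing B] [IsDedekindDomain B]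
    [Algebra B K] [IsFractionRing B K] [Algebra ℂ B] [IsScalarTower ℂ B K]
    (v : IsDedekindDomain.HeightOneSpectrum B) : Point K where
  ring := v.valuationSubringAtPrime K
  algebraMap_mem c := by
    rw [IsDedekindDomain.HeightOneSpectrum.valuationSubringAtPrime_eq_valuationSubring,
      Valuation.mem_valuationSubring_iff, IsScalarTower.algebraMap_apply ℂ B K]
    exact v.valuation_le_one _
  isDVR := IsLocalization.AtPrime.isDiscreteValuationRing_of_dedekind_domain B v.ne_bot _

theorem mem_pointOfHeightOne {K B : Type*} [Field K] [Algebra ℂ K] [CommRing B]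
    [IsDedekindDomain B] [Algebra B K] [IsFractionRing B K] [Algebra ℂ B] [IsScalarTower ℂ B K]
    (v : IsDedekindDomain.HeightOneSpectrum B) (z : K) :
    z ∈ (pointOfHeightOne v : Point K).ring ↔ v.valuation K z ≤ 1 := by
  change z ∈ v.valuationSubringAtPrime K ↔ _
  rw [IsDedekindDomain.HeightOneSpectrum.valuationSubringAtPrime_eq_valuationSubring,
    Valuation.mem_valuationSubring_iff]

/-- A function without poles outside the poles of `u` is integral over `ℂ[u]`. -/
theorem isIntegralElem_of_forall_point {K : Type*} [Field K] [Algebra ℂ K] (φ : RatFunc ℂ →+* K)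
    (hφ : φ.Finite) (hφc : ∀ c : ℂ, φ (algebraMap ℂ _ c) = algebraMap ℂ K c) {F : K}
    (hF : ∀ P : Point K, φ RatFunc.X ∈ P.ring → F ∈ P.ring) :
    (φ.comp (algebraMap ℂ[X] (RatFunc ℂ))).IsIntegralElem F := by
  -- The algebra structures come from φ, so that u = φ(X) can be x as well as 1/x.
  let : Algebra (RatFunc ℂ) K := φ.toAlgebra
  let : Algebra ℂ[X] K := (φ.comp (algebraMap ℂ[X] (RatFunc ℂ))).toAlgebra
  have : IsScalarTower ℂ[X] (RatFunc ℂ) K := IsScalarTower.of_algebraMap_eq fun _ => rfl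
  have : IsScalarTower ℂ ℂ[X] K := IsScalarTower.of_algebraMap_eq fun c => by
    rw [← hφc, IsScalarTower.algebraMap_apply ℂ ℂ[X] (RatFunc ℂ)]; rfl
  have : FiniteDimensional (RatFunc ℂ) K := hφ
  have : IsDedekindDomain (integralClosure ℂ[X] K) :=
    integralClosure.isDedekindDomain ℂ[X] (RatFunc ℂ) K
  have : IsFractionRing (integralClosure ℂ[X] K) K :=
    integralClosure.isFractionRing_of_finite_extension (RatFunc ℂ) K
  -- A Dedekind domain is the intersection of its localizations at nonzero primes, and each such
  -- prime of the integral closure is a point where u is regular.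
  obtain ⟨b, rfl⟩ := IsDedekindDomain.HeightOneSpectrum.mem_integers_of_valuation_le_one
    (R := integralClosure ℂ[X] K) K F fun v => by
      rw [← mem_pointOfHeightOne]
      refine hF _ ?_
      rw [mem_pointOfHeightOne]
      have : φ RatFunc.X = algebraMap (integralClosure ℂ[X] K) K (algebraMap ℂ[X] _ X) := by
        rw [← IsScalarTower.algebraMap_apply, ← RatFunc.algebraMap_X]; rfl
      rw [this]
      exact v.valuation_le_one _
  exact b.2

theorem isIntegralElem_comp_iff {R S T : Type*} [CommRing R] [CommRing S] [CommRing T]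
    (f : R →+* S) {g : S →+* T} (hg : Function.Injective g) {z : S} :
    (g.comp f).IsIntegralElem (g z) ↔ f.IsIntegralElem z := by
  refine exists_congr fun p => and_congr_right fun _ => ?_
  rw [← hom_eval₂, map_eq_zero_iff g hg]

theorem transcendental_inv_X : Transcendental ℂ (RatFunc.X⁻¹ : RatFunc ℂ) := fun h =>
  RatFunc.transcendental_X (by simpa using h.inv)

/-- The automorphism `X ↦ X⁻¹` of the field of rational functions. -/
def ratFuncInv : RatFunc ℂ →+* RatFunc ℂ :=
  RatFunc.liftRingHom (aeval (RatFunc.X⁻¹ : RatFunc ℂ)).toRingHom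
    (nonZeroDivisors_le_comap_nonZeroDivisors_of_injective _
      (transcendental_iff_injective.1 transcendental_inv_X))

theorem ratFuncInv_algebraMap (p : ℂ[X]) :
    ratFuncInv (algebraMap ℂ[X] _ p) = aeval (RatFunc.X⁻¹ : RatFunc ℂ) p := by
  rw [ratFuncInv, RatFunc.liftRingHom_algebraMap]; rfl

theorem ratFuncInv_X : ratFuncInv RatFunc.X = RatFunc.X⁻¹ := by
  rw [← RatFunc.algebraMap_X, ratFuncInv_algebraMap, aeval_X, RatFunc.algebraMap_X]

theorem ratFuncInv_const (c : ℂ) : ratFuncInv (algebraMap ℂ _ c) = algebraMap ℂ _ c := by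
  rw [IsScalarTower.algebraMap_apply ℂ ℂ[X] (RatFunc ℂ), ratFuncInv_algebraMap, ← C_eq_algebraMap,
    aeval_C, IsScalarTower.algebraMap_apply ℂ ℂ[X] (RatFunc ℂ), C_eq_algebraMap]

theorem ratFuncInv_ratFuncInv (r : RatFunc ℂ) : ratFuncInv (ratFuncInv r) = r := by
  have h : ratFuncInv.comp ratFuncInv = RingHom.id (RatFunc ℂ) := by
    refine IsLocalization.ringHom_ext (nonZeroDivisors ℂ[X]) (Polynomial.ringHom_ext ?_ ?_)
    · intro c
      change ratFuncInv (ratFuncInv (algebraMap ℂ _ c)) = algebraMap ℂ _ c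
      rw [ratFuncInv_const, ratFuncInv_const]
    · simp [ratFuncInv_X]
  exact congrArg (fun f : RatFunc ℂ →+* RatFunc ℂ => f r) h

/-- A polynomial of the form `X ^ k q(1 / X)` has degree at most `k`. -/
theorem natDegree_le_of_isIntegralElem {p : ℂ[X]} {k : ℕ}
    (h : (ratFuncInv.comp (algebraMap ℂ[X] (RatFunc ℂ))).IsIntegralElem
      (algebraMap ℂ[X] (RatFunc ℂ) p / RatFunc.X ^ k)) : p.natDegree ≤ k := by
  -- Applying X ↦ 1/X turns the hypothesis into integrality of X^k p(1/X) over ℂ[X], so this is a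
  -- polynomial q.
  rw [← ratFuncInv_ratFuncInv (_ / _), isIntegralElem_comp_iff _ ratFuncInv.injective] at h
  obtain ⟨q, hq⟩ := IsIntegrallyClosed.isIntegral_iff.1 h
  rw [map_div₀, map_pow, ratFuncInv_X, ratFuncInv_algebraMap] at hq
  by_contra! hlt
  have hX : (RatFunc.X : RatFunc ℂ) ≠ 0 := RatFunc.X_ne_zero
  let := invertibleOfNonzero (inv_ne_zero hX)
  have h1 := eval₂_reverse_mul_pow (algebraMap ℂ (RatFunc ℂ)) RatFunc.X⁻¹ p
  rw [invOf_eq_inv, inv_inv, ← aeval_def, ← aeval_def] at h1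
  have h2 : aeval (RatFunc.X : RatFunc ℂ) p.reverse = algebraMap ℂ[X] _ p.reverse := by
    rw [← RatFunc.algebraMap_X, aeval_algebraMap_apply, aeval_X_left_apply]
  have h3 : algebraMap ℂ[X] (RatFunc ℂ) p.reverse =
      algebraMap ℂ[X] (RatFunc ℂ) (q * X ^ (p.natDegree - k)) := by
    rw [map_mul, map_pow, RatFunc.algebraMap_X, hq, ← h2, ← h1, pow_sub₀ _ hX hlt.le]
    simp only [inv_pow]
    field_simp
  -- If deg p > k, the right side vanishes at 0, while the constant term of the reverse is the
  -- leading coefficient of p.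
  have h4 := congrArg (fun p => p.coeff 0) (IsFractionRing.injective ℂ[X] (RatFunc ℂ) h3)
  simp only [coeff_zero_reverse, mul_coeff_zero, coeff_X_pow] at h4
  rw [if_neg (by omega), mul_zero, leadingCoeff_eq_zero] at h4
  simp [h4] at hlt

end Integrality

/-! ### The space of functions p(x) + c y -/

namespace Octic

variable (C : Octic)

/-- The hyperelliptic involution. -/
def involution : C.FunctionField →ₐ[RatFunc ℂ] C.FunctionField :=
  AdjoinRoot.liftAlgHom C.equation (Algebra.ofId _ _) (-C.y) (by
    change eval₂ (algebraMap (RatFunc ℂ) C.FunctionField) (-C.y)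
      (X ^ 2 - Polynomial.C (algebraMap ℂ[X] (RatFunc ℂ) C.g)) = 0
    rw [eval₂_sub, eval₂_pow, eval₂_X, eval₂_C, neg_sq, C.y_sq', sub_self])

theorem involution_y : C.involution C.y = -C.y := AdjoinRoot.liftAlgHom_root _ _ _ _

/-- The conjugate a - b y satisfies the same integral equation. Hence a, half the trace, is
integral, and so are b y and its square b² g. A general θ covers both ℂ[x] and ℂ[1/x]. -/
theorem isIntegralElem_coords (θ : ℂ[X] →+* RatFunc ℂ) {a b : RatFunc ℂ}
    (h : ((algebraMap (RatFunc ℂ) C.FunctionField).comp θ).IsIntegralElem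
      (algebraMap _ _ a + algebraMap _ _ b * C.y)) :
    θ.IsIntegralElem a ∧ θ.IsIntegralElem (b ^ 2 * algebraMap ℂ[X] _ C.g) := by
  set ψ := (algebraMap (RatFunc ℂ) C.FunctionField).comp θ with hψ
  have h' : ψ.IsIntegralElem (algebraMap _ _ a - algebraMap _ _ b * C.y) := by
    obtain ⟨p, hp, h0⟩ := h
    refine ⟨p, hp, ?_⟩
    have h1 := congrArg C.involution h0
    rw [← AlgHom.coe_toRingHom, hom_eval₂, ← RingHom.comp_assoc, AlgHom.comp_algebraMap, ← hψ] at h1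
    have e : C.involution (algebraMap _ _ a + algebraMap _ _ b * C.y) =
        algebraMap _ _ a - algebraMap _ _ b * C.y := by
      rw [map_add, map_mul, AlgHom.commutes, AlgHom.commutes, involution_y]
      ring
    rwa [AlgHom.coe_toRingHom, e, map_zero] at h1
  have half : ψ (Polynomial.C (1 / 2)) * 2 = 1 := by
    rw [← map_ofNat ψ 2, ← map_mul, ← map_ofNat Polynomial.C 2, ← Polynomial.C_mul]
    norm_num
  have ha : ψ.IsIntegralElem (algebraMap _ C.FunctionField a) := by
    have h1 := (ψ.isIntegralElem_map (x := Polynomial.C (1 / 2))).mul _ (h.add _ h')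
    have e : algebraMap _ C.FunctionField a = ψ (Polynomial.C (1 / 2)) *
        (algebraMap _ _ a + algebraMap _ _ b * C.y + (algebraMap _ _ a - algebraMap _ _ b * C.y)) := by
      linear_combination -algebraMap _ C.FunctionField a * half
    rwa [e]
  have hb : ψ.IsIntegralElem (algebraMap _ C.FunctionField (b ^ 2 * algebraMap ℂ[X] _ C.g)) := by
    have h1 := h.sub _ ha
    have e : algebraMap _ C.FunctionField (b ^ 2 * algebraMap ℂ[X] _ C.g) =
        (algebraMap _ _ a + algebraMap _ _ b * C.y - algebraMap _ _ a) *
          (algebraMap _ _ a + algebraMap _ _ b * C.y - algebraMap _ _ a) := by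
      rw [map_mul, ← C.y_sq', map_pow]
      ring
    rw [e]
    exact h1.mul _ h1
  have hinj := (algebraMap (RatFunc ℂ) C.FunctionField).injective
  exact ⟨(isIntegralElem_comp_iff θ hinj).1 ha, (isIntegralElem_comp_iff θ hinj).1 hb⟩

/-- The Riemann-Roch space of functions with poles of order at most four at infinity. -/
theorem eq_aeval_add_of_forall_point {F : C.FunctionField}
    (h1 : ∀ P : Point C.FunctionField, C.x ∈ P.ring → F ∈ P.ring)
    (h2 : ∀ P : Point C.FunctionField, C.x ∉ P.ring → F / C.x ^ 4 ∈ P.ring) :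
    ∃ (p : ℂ[X]) (c : ℂ), p.natDegree ≤ 4 ∧ F = aeval C.x p + algebraMap ℂ _ c * C.y := by
  obtain ⟨a, b, rfl⟩ := C.exists_eq_add_mul_y F
  set φ := algebraMap (RatFunc ℂ) C.FunctionField with hφdef
  have hφ : φ.Finite := RingHom.finite_algebraMap.2 inferInstance
  have hc (c : ℂ) : φ (algebraMap ℂ _ c) = algebraMap ℂ C.FunctionField c :=
    (IsScalarTower.algebraMap_apply ℂ (RatFunc ℂ) _ c).symm
  obtain ⟨ha, hb⟩ := C.isIntegralElem_coords _ (isIntegralElem_of_forall_point φ hφ hc h1)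
  obtain ⟨p, rfl⟩ := IsIntegrallyClosed.isIntegral_iff.1 ha
  obtain ⟨N, hN⟩ := IsIntegrallyClosed.isIntegral_iff.1 hb
  have h3 := isIntegralElem_of_forall_point (φ.comp ratFuncInv)
    (hφ.comp (RingHom.Finite.of_surjective _ fun r => ⟨_, ratFuncInv_ratFuncInv r⟩))
    (fun c => by rw [RingHom.comp_apply, ratFuncInv_const, hc])
    (F := φ (algebraMap ℂ[X] _ p / RatFunc.X ^ 4) + φ (b / RatFunc.X ^ 4) * C.y) fun P hP => by
      have hX : φ RatFunc.X = C.x := rfl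
      rw [RingHom.comp_apply, ratFuncInv_X, map_inv₀, hX] at hP
      have e : φ (algebraMap ℂ[X] _ p / RatFunc.X ^ 4) + φ (b / RatFunc.X ^ 4) * C.y =
          (φ (algebraMap ℂ[X] _ p) + φ b * C.y) / C.x ^ 4 := by
        rw [map_div₀, map_div₀, map_pow, hX]; ring
      rw [e]
      -- Where x and 1/x are both regular, F and (1/x)⁴ are regular; the remaining points are those
      -- at infinity.
      by_cases hx : C.x ∈ P.ring
      · rw [div_eq_mul_inv, ← inv_pow]
        exact P.ring.mul_mem _ _ (h1 P hx) (pow_mem hP 4)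
      · exact h2 P hx
  rw [RingHom.comp_assoc] at h3
  obtain ⟨ha', hb'⟩ := C.isIntegralElem_coords _ h3
  have hp := natDegree_le_of_isIntegralElem ha'
  rw [div_pow, ← pow_mul, div_mul_eq_mul_div, ← hN] at hb'
  have hN8 := natDegree_le_of_isIntegralElem hb'
  have hg0 : algebraMap ℂ[X] (RatFunc ℂ) C.g ≠ 0 :=
    (map_ne_zero_iff _ (IsFractionRing.injective ℂ[X] (RatFunc ℂ))).2 C.g_ne_zero
  -- With N = b² g a polynomial, (b g)² = N g is one too, so b g is a polynomial d. Then g divides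
  -- d², hence d since g is squarefree, and b is a polynomial.
  obtain ⟨d, hd⟩ : ∃ d : ℂ[X], algebraMap ℂ[X] _ d = b * algebraMap ℂ[X] (RatFunc ℂ) C.g := by
    refine IsIntegrallyClosed.exists_algebraMap_eq_of_isIntegral_pow (R := ℂ[X]) (n := 2) two_pos ?_
    rw [mul_pow, sq (algebraMap _ _ C.g), ← mul_assoc, ← hN, ← map_mul]
    exact isIntegral_algebraMap
  have hdvd : C.g ∣ d := by
    refine (C.separable.squarefree.dvd_pow_iff_dvd two_ne_zero).1 ⟨N, ?_⟩
    apply IsFractionRing.injective ℂ[X] (RatFunc ℂ)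
    rw [map_pow, hd, map_mul, hN]
    ring
  obtain ⟨e, rfl⟩ := hdvd
  obtain rfl : b = algebraMap ℂ[X] _ e := by
    rw [map_mul, mul_comm] at hd
    exact (mul_right_cancel₀ hg0 hd).symm
  have hNe : N = e ^ 2 * C.g := by
    apply IsFractionRing.injective ℂ[X] (RatFunc ℂ)
    rw [hN, map_mul, map_pow]
  -- The bound at infinity gives 2 deg e + 8 = deg N ≤ 8.
  have he : e.natDegree = 0 := by
    rcases eq_or_ne e 0 with rfl | he0
    · simp
    rw [hNe, natDegree_mul (pow_ne_zero 2 he0) C.g_ne_zero, natDegree_pow, C.natDegree_eq] at hN8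
    omega
  obtain ⟨c, rfl⟩ := natDegree_eq_zero.1 he
  refine ⟨p, c, hp, ?_⟩
  rw [← algebraMap_eq_aeval, IsScalarTower.algebraMap_apply ℂ[X] (RatFunc ℂ), ← hc]
  rfl

variable {C}

theorem mem_H0_iff_exists {ω : QDiff C.FunctionField 2} :
    ω ∈ H0 C.FunctionField 2 ↔ ∃ (p : ℂ[X]) (c : ℂ), p.natDegree ≤ 4 ∧
      C.quadCoord ω = aeval C.x p + algebraMap ℂ _ c * C.y := by
  rw [mem_H0_iff]
  refine ⟨fun h => C.eq_aeval_add_of_forall_point h.1 h.2, ?_⟩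
  rintro ⟨p, c, hp, h⟩
  rw [h]
  constructor
  · intro P hx
    obtain ⟨w, hw⟩ := mem_ring_iff_exists_hasValue.1 hx
    obtain ⟨s, hs, -⟩ := hw.exists_of_sq C.y_sq
    exact ((hw.aeval p).add ((Point.hasValue_algebraMap c).mul hs)).mem
  · intro P hx
    have hw : P.HasValue C.x⁻¹ 0 := by simpa [Point.HasValue] using val_inv_x_lt hx
    obtain ⟨s, hs, -⟩ := hw.exists_of_sq C.y_div_sq
    let := invertibleOfNonzero C.x_ne_zero
    -- As deg p ≤ 4, p(x)/x⁴ is a polynomial in 1/x, and y/x⁴ also has a value at infinity.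
    have h1 := eval₂_reflect_mul_pow (algebraMap ℂ C.FunctionField) C.x 4 p hp
    rw [← aeval_def, ← aeval_def, invOf_eq_inv] at h1
    rw [add_div, mul_div_assoc, ← h1, mul_div_cancel_right₀ _ (pow_ne_zero 4 C.x_ne_zero)]
    exact ((hw.aeval _).add ((Point.hasValue_algebraMap c).mul hs)).mem

end Octic

/-! ### Taylor polynomials and orders of vanishing -/

section Taylor

open Filter Topology Asymptotics

theorem X_sub_C_pow_dvd_of_isBigO {w : ℂ} (n : ℕ) : ∀ {q : ℂ[X]},
    (fun z => q.eval (w + z)) =O[𝓝[≠] 0] (fun z : ℂ => z ^ n) → (X - Polynomial.C w) ^ n ∣ q := by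
  induction n with
  | zero => intro q _; simp
  | succ n ih =>
    intro q hq
    have hlim : Tendsto (fun z => q.eval (w + z)) (𝓝[≠] 0) (𝓝 (q.eval w)) := by
      have h : Continuous fun z => q.eval (w + z) := by fun_prop
      simpa using (h.tendsto 0).mono_left nhdsWithin_le_nhds
    have hlim0 : Tendsto (fun z : ℂ => z ^ (n + 1)) (𝓝[≠] 0) (𝓝 0) := by
      simpa using ((continuous_pow (n + 1)).tendsto (0 : ℂ)).mono_left nhdsWithin_le_nhds
    have h0 : q.eval w = 0 := tendsto_nhds_unique hlim (hq.trans_tendsto hlim0)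
    obtain ⟨r, rfl⟩ := dvd_iff_isRoot.2 h0
    rw [pow_succ']
    refine mul_dvd_mul_left _ (ih ?_)
    -- The punctured neighbourhood allows division of the estimate by z after the root w is split
    -- off.
    have hne : ∀ᶠ z : ℂ in 𝓝[≠] 0, z ≠ 0 := eventually_mem_nhdsWithin
    refine (hq.mul (isBigO_refl (fun z : ℂ => z⁻¹) _)).congr' ?_ ?_
    · filter_upwards [hne] with z hz
      simp only [eval_mul, eval_sub, eval_X, eval_C]
      field_simp
      ring
    · filter_upwards [hne] with z hz
      rw [pow_succ, mul_inv_cancel_right₀ hz]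

end Taylor

namespace Octic

variable (C : Octic) {w s : ℂ}

theorem eval_taylorPoly (z : ℂ) : (C.taylorPoly w s).eval (w + z) =
    (FormalMultilinearSeries.ofScalars ℂ
      fun n => iteratedDeriv n (C.branch w s) w / (n.factorial : ℂ)).partialSum 5 z := by
  simp [taylorPoly, eval_finsetSum, FormalMultilinearSeries.partialSum, mul_comm]

theorem eval_taylorPoly_self (hw : C.g.eval w ≠ 0) : (C.taylorPoly w s).eval w = s := by
  simp [taylorPoly, Finset.sum_range_succ', C.branch_self s hw]

theorem natDegree_taylorPoly_le : (C.taylorPoly w s).natDegree ≤ 4 := by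
  refine natDegree_sum_le_of_forall_le _ _ fun n hn => (natDegree_C_mul_le _ _).trans ?_
  rw [natDegree_pow, natDegree_X_sub_C, mul_one]
  have := Finset.mem_range.1 hn
  omega

open Filter Topology Asymptotics in
/-- The Taylor polynomial is a square root of `g` up to the fifth order. -/
theorem X_sub_C_pow_dvd_sub_taylorPoly_sq (hw : C.g.eval w ≠ 0) (hs : s ^ 2 = C.g.eval w) :
    (X - Polynomial.C w) ^ 5 ∣ C.g - C.taylorPoly w s ^ 2 := by
  apply X_sub_C_pow_dvd_of_isBigO
  have hφ := C.branch_analyticAt s hw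
  have h1 := hφ.hasFPowerSeriesAt.isBigO_sub_partialSum_pow 5
  simp only [← eval_taylorPoly, ← norm_pow] at h1
  have h2 : (fun z => C.branch w s (w + z) + (C.taylorPoly w s).eval (w + z)) =O[𝓝 0]
      (fun _ => (1 : ℂ)) := by
    have hc : ContinuousAt (fun z => C.branch w s (w + z)) 0 :=
      ContinuousAt.comp (g := C.branch w s) (by rw [add_zero]; exact hφ.continuousAt)
        (continuous_const_add w).continuousAt
    have hc' : ContinuousAt (fun z => (C.taylorPoly w s).eval (w + z)) 0 :=
      Continuous.continuousAt (by fun_prop)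
    exact (hc.add hc').tendsto.isBigO_one ℂ
  -- g - f² = (φ - f)(φ + f), where the first factor is O(z⁵) and the second is bounded.
  refine ((h1.of_norm_right.mul h2).mono nhdsWithin_le_nhds).congr_left (fun z => ?_) |>.congr_right
    fun z => mul_one _
  rw [eval_sub, eval_pow, ← C.branch_sq hw hs]
  ring

/-- Otherwise g would be a square. Nonvanishing matters because `Point.ord` assigns 0 to the zero
function. -/
theorem y_sub_aeval_ne_zero (p : ℂ[X]) : C.y - aeval C.x p ≠ 0 := fun h => by
  have h1 := C.y_sq
  rw [sub_eq_zero.1 h, ← map_pow] at h1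
  have h2 := congrArg natDegree (C.aeval_x_injective h1)
  have h3 : IsUnit p := C.separable.squarefree p ⟨1, by rw [← C.aeval_x_injective h1]; ring⟩
  rw [natDegree_pow, natDegree_eq_zero_of_isUnit h3, C.natDegree_eq] at h2
  omega

end Octic

/-! ### Orders of linear combinations -/

namespace Point

variable {K : Type*} [Field K] [Algebra ℂ K] {P : Point K}

theorem val_eq_exp_neg_ord {z : K} (hz : z ≠ 0) : P.val z = WithZero.exp (-P.ord z) := by
  rw [ord, neg_neg, WithZero.exp_log ((Valuation.ne_zero_iff _).2 hz)]

/-- Nonzero constants are units, so the term with the least index among nonzero coefficients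
strictly dominates. -/
theorem exists_val_sum_eq {d : ℕ} {f : Fin d → K} (hf : ∀ i, f i ≠ 0)
    (hord : StrictMono fun i => P.ord (f i)) {c : Fin d → ℂ} (hc : c ≠ 0) :
    ∃ i, P.val (∑ i, c i • f i) = P.val (f i) := by
  classical
  obtain ⟨i₀, hi₀⟩ := Function.ne_iff.1 hc
  obtain ⟨i, hi, hmin⟩ := Finset.exists_min_image (Finset.univ.filter fun i => c i ≠ 0) id
    ⟨i₀, by simpa using hi₀⟩
  have hci : c i ≠ 0 := by simpa using hi
  have hval : P.val (c i • f i) = P.val (f i) := by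
    rw [Algebra.smul_def, map_mul, P.val_algebraMap hci, one_mul]
  refine ⟨i, ?_⟩
  rw [← hval]
  refine Valuation.map_sum_eq_of_lt P.val (Finset.mem_univ i) fun j hj => ?_
  rw [hval]
  rcases eq_or_ne (c j) 0 with h0 | h0
  · rw [h0, zero_smul, map_zero]
    exact zero_lt_iff.2 ((Valuation.ne_zero_iff _).2 (hf i))
  · have hij : i < j := lt_of_le_of_ne (hmin j (by simpa using h0)) (by
      rintro rfl; simp at hj)
    rw [Algebra.smul_def, map_mul, P.val_algebraMap h0, one_mul, val_eq_exp_neg_ord (hf j),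
      val_eq_exp_neg_ord (hf i), WithZero.exp_lt_exp]
    exact neg_lt_neg (hord hij)

end Point

/-! ### The adapted basis, gap sequences and weights -/

namespace Octic

variable {C : Octic} {P : Point C.FunctionField} {w s : ℂ}

theorem quadCoord_smul (c : ℂ) (ω : QDiff C.FunctionField 2) :
    C.quadCoord (c • ω) = c • C.quadCoord ω := by
  rw [← algebraMap_smul C.FunctionField c ω, map_smul, algebraMap_smul]

theorem quadCoord_sum {d : ℕ} (c : Fin d → ℂ) (v : Fin d → H0 C.FunctionField 2) :
    C.quadCoord ((∑ i, c i • v i : H0 C.FunctionField 2) : QDiff C.FunctionField 2) =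
      ∑ i, c i • C.quadCoord (v i) := by
  rw [Submodule.coe_sum, map_sum]
  exact Finset.sum_congr rfl fun i _ => quadCoord_smul _ _

theorem quadCoord_ne_zero {ω : H0 C.FunctionField 2} (h : ω ≠ 0) :
    C.quadCoord (ω : QDiff C.FunctionField 2) ≠ 0 := by
  rw [Ne, LinearEquiv.map_eq_zero_iff, Submodule.coe_eq_zero]
  exact h

/-- The orders of a basis adapted to `P` are all the orders of nonzero holomorphic differentials. -/
theorem exists_qOrd_eq (hx : C.x ∈ P.ring) {d : ℕ} (ψ : Module.Basis (Fin d) ℂ (H0 C.FunctionField 2))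
    (hψ : StrictMono fun i => P.qOrd (ψ i : QDiff C.FunctionField 2)) {ω : H0 C.FunctionField 2}
    (hω : ω ≠ 0) :
    ∃ i, P.qOrd (ψ i : QDiff C.FunctionField 2) = P.qOrd (ω : QDiff C.FunctionField 2) := by
  simp only [qOrd_eq hx] at hψ ⊢
  have hc : (fun i => ψ.repr ω i) ≠ 0 := fun h => hω <| by
    rw [← ψ.sum_repr ω]
    exact Finset.sum_eq_zero fun i _ => by rw [show ψ.repr ω i = 0 from congrFun h i, zero_smul]
  obtain ⟨i, hi⟩ := Point.exists_val_sum_eq (fun i => quadCoord_ne_zero (ψ.ne_zero i)) hψ hc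
  rw [← quadCoord_sum, ψ.sum_repr] at hi
  exact ⟨i, by rw [Point.ord, Point.ord, hi]⟩

/-- Both order sequences enumerate increasingly the set of orders of nonzero holomorphic
differentials. -/
theorem qOrd_basis_unique (hx : C.x ∈ P.ring) {d : ℕ}
    {ψ ψ' : Module.Basis (Fin d) ℂ (H0 C.FunctionField 2)}
    (hψ : StrictMono fun i => P.qOrd (ψ i : QDiff C.FunctionField 2))
    (hψ' : StrictMono fun i => P.qOrd (ψ' i : QDiff C.FunctionField 2)) :
    (fun i => P.qOrd (ψ i : QDiff C.FunctionField 2)) =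
      fun i => P.qOrd (ψ' i : QDiff C.FunctionField 2) := by
  refine (StrictMono.range_inj hψ hψ').1 (Set.Subset.antisymm ?_ ?_)
  · rintro _ ⟨i, rfl⟩
    exact exists_qOrd_eq hx ψ' hψ' (ψ.ne_zero i)
  · rintro _ ⟨i, rfl⟩
    exact exists_qOrd_eq hx ψ hψ (ψ'.ne_zero i)

variable (C w s) in
/-- The functions `F` of the differentials `F (dx)² / y²` in `basisDiff`. -/
def basisFun : Fin 6 → C.FunctionField :=
  Fin.snoc (α := fun _ => C.FunctionField)
    (fun j : Fin 5 => (C.x - algebraMap ℂ C.FunctionField w) ^ (j : ℕ))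
    (C.y - aeval C.x (C.taylorPoly w s))

theorem basisFun_castSucc (j : Fin 5) : C.basisFun w s j.castSucc =
    (C.x - algebraMap ℂ C.FunctionField w) ^ (j : ℕ) :=
  Fin.snoc_castSucc (α := fun _ => C.FunctionField) _ _ _

theorem basisFun_last : C.basisFun w s (Fin.last 5) = C.y - aeval C.x (C.taylorPoly w s) :=
  Fin.snoc_last (α := fun _ => C.FunctionField) _ _

theorem basisDiff_eq (i : Fin 6) :
    C.basisDiff w s i = (C.basisFun w s i / C.y ^ 2) • dPow 2 C.x := by
  refine Fin.lastCases ?_ (fun j => ?_) i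
  · rw [basisFun_last]
    exact Fin.snoc_last (α := fun _ => QDiff C.FunctionField 2) _ _
  · rw [basisFun_castSucc]
    exact Fin.snoc_castSucc (α := fun _ => QDiff C.FunctionField 2) _ _ _

theorem quadCoord_basisDiff (i : Fin 6) : C.quadCoord (C.basisDiff w s i) = C.basisFun w s i := by
  rw [basisDiff_eq, quadCoord_smul_dPow, deriv_x, mul_one,
    div_mul_cancel₀ _ (pow_ne_zero 2 C.y_ne_zero)]

theorem basisFun_ne_zero (i : Fin 6) : C.basisFun w s i ≠ 0 := by
  refine Fin.lastCases ?_ (fun j => ?_) i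
  · rw [basisFun_last]
    exact C.y_sub_aeval_ne_zero _
  · rw [basisFun_castSucc]
    exact pow_ne_zero _ (x_sub_ne_zero w)

theorem basisDiff_mem_H0 (i : Fin 6) : C.basisDiff w s i ∈ H0 C.FunctionField 2 := by
  rw [mem_H0_iff_exists, quadCoord_basisDiff]
  refine Fin.lastCases ?_ (fun j => ?_) i
  · rw [basisFun_last]
    exact ⟨-C.taylorPoly w s, 1, by rw [natDegree_neg]; exact C.natDegree_taylorPoly_le,
      by simp; ring⟩
  · rw [basisFun_castSucc]
    refine ⟨(X - Polynomial.C w) ^ (j : ℕ), 0, ?_, by simp⟩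
    rw [natDegree_pow, natDegree_X_sub_C, mul_one]
    omega

theorem exists_sum_smul_basisFun_eq {p : ℂ[X]} (hp : p.natDegree ≤ 4) (c : ℂ) :
    ∃ a : Fin 6 → ℂ, ∑ i, a i • C.basisFun w s i = aeval C.x p + algebraMap ℂ _ c * C.y := by
  -- p + c y = (p + c f) + c (y - f); the first summand has degree at most 4 and is expanded in
  -- powers of x - w.
  set q := p + Polynomial.C c * C.taylorPoly w s with hq
  have hqd : q.natDegree ≤ 4 := (natDegree_add_le_of_degree_le hp
    ((natDegree_C_mul_le _ _).trans C.natDegree_taylorPoly_le))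
  have hsum : ∑ i : Fin 5, Polynomial.C ((taylor w q).coeff i) * (X - Polynomial.C w) ^ (i : ℕ) =
      q := by
    have hd : (taylor w q).degree < (5 : ℕ) := by
      rw [degree_taylor]
      exact degree_le_natDegree.trans_lt (by exact_mod_cast Nat.lt_succ_of_le hqd)
    conv_rhs => rw [← sum_taylor_eq q w]
    exact Polynomial.sum_fin (fun i a => Polynomial.C a * (X - Polynomial.C w) ^ i) (by simp) hd
  refine ⟨Fin.snoc (α := fun _ => ℂ) (fun i : Fin 5 => (taylor w q).coeff i) c, ?_⟩
  rw [Fin.sum_univ_castSucc]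
  simp only [Fin.snoc_castSucc, Fin.snoc_last, basisFun_castSucc, basisFun_last]
  have h := congrArg (aeval C.x) hsum
  simp only [map_sum, map_mul, map_pow, map_sub, aeval_X, aeval_C] at h
  simp only [Algebra.smul_def]
  rw [h, hq, map_add, map_mul, aeval_C]
  ring

theorem ord_basisFun (hw : C.g.eval w ≠ 0) (hPx : P.HasValue C.x w) (hPy : P.HasValue C.y s) :
    (∀ j : Fin 5, P.ord (C.basisFun w s j.castSucc) = j) ∧
      5 ≤ P.ord (C.basisFun w s (Fin.last 5)) := by
  have hsq : s ^ 2 = C.g.eval w := by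
    have h := hPx.aeval C.g
    rw [← C.y_sq, sq] at h
    rw [sq, (hPy.mul hPy).unique h]
  have hs : s ≠ 0 := by
    rintro rfl
    exact hw (by rw [← hsq, zero_pow two_ne_zero])
  have hτ := (val_derivation_of_ne_zero C.adjoin_x_y C.y_sq hPx hPy hs (x_sub_ne_zero w) C.deriv
    C.deriv_x_ne_zero).1
  constructor
  · intro j
    rw [basisFun_castSucc, Point.ord, map_pow, hτ, ← WithZero.exp_nsmul, WithZero.log_exp]
    simp
  · obtain ⟨r, hr⟩ := C.X_sub_C_pow_dvd_sub_taylorPoly_sq hw hsq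
    have h := congrArg (fun p => P.val (aeval C.x p)) hr
    -- Its value at P is s + f(w) = 2s ≠ 0.
    have hplus : P.val (C.y + aeval C.x (C.taylorPoly w s)) = 1 := by
      refine (hPy.add (hPx.aeval _)).val_eq_one ?_
      rw [C.eval_taylorPoly_self hw, ← two_mul]
      exact mul_ne_zero two_ne_zero hs
    have e : aeval C.x (C.g - C.taylorPoly w s ^ 2) =
        (C.y + aeval C.x (C.taylorPoly w s)) * (C.y - aeval C.x (C.taylorPoly w s)) := by
      rw [map_sub, ← C.y_sq, map_pow]; ring
    simp only [e, map_mul, hplus, one_mul, map_pow, map_sub, aeval_X, aeval_C, hτ] at h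
    have hle : P.val (C.y - aeval C.x (C.taylorPoly w s)) ≤ WithZero.exp (-5 : ℤ) := by
      rw [h, ← WithZero.exp_nsmul]
      exact mul_le_of_le_one_right' (P.val_le_one_iff.2 (hPx.aeval r).mem)
    rw [Point.val_eq_exp_neg_ord (C.y_sub_aeval_ne_zero _), WithZero.exp_le_exp] at hle
    rw [basisFun_last]
    omega

theorem exists_basis_eq_basisDiff (hord : StrictMono fun i => P.ord (C.basisFun w s i)) :
    ∃ ψ : Module.Basis (Fin 6) ℂ (H0 C.FunctionField 2),
      ∀ i, (ψ i : QDiff C.FunctionField 2) = C.basisDiff w s i := by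
  set v : Fin 6 → H0 C.FunctionField 2 := fun i => ⟨C.basisDiff w s i, basisDiff_mem_H0 i⟩ with hv
  have hsum (c : Fin 6 → ℂ) :
      C.quadCoord ((∑ i, c i • v i : H0 C.FunctionField 2) : QDiff C.FunctionField 2) =
        ∑ i, c i • C.basisFun w s i := by
    simp only [quadCoord_sum, hv, quadCoord_basisDiff]
  have hli : LinearIndependent ℂ v := by
    refine Fintype.linearIndependent_iff.2 fun c hc => ?_
    by_contra! hne
    obtain ⟨i, hi⟩ := Point.exists_val_sum_eq basisFun_ne_zero hord (c := c)
      (Function.ne_iff.2 hne)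
    rw [← hsum, hc, Submodule.coe_zero, map_zero, map_zero] at hi
    exact basisFun_ne_zero i ((Valuation.zero_iff _).1 hi.symm)
  have hspan : ⊤ ≤ Submodule.span ℂ (Set.range v) := by
    rintro ω -
    obtain ⟨p, c, hp, h⟩ := mem_H0_iff_exists.1 ω.2
    obtain ⟨a, ha⟩ := exists_sum_smul_basisFun_eq (w := w) (s := s) hp c
    have : ω = ∑ i, a i • v i :=
      Subtype.ext (C.quadCoord.injective (by rw [hsum, ha, h]))
    rw [this]
    exact Submodule.sum_mem _ fun i _ => Submodule.smul_mem _ _ (Submodule.subset_span ⟨i, rfl⟩)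
  exact ⟨Module.Basis.mk hli hspan, fun i => by rw [Module.Basis.mk_apply]⟩

theorem card_of_isGapSequence {d d' : ℕ} {n : Fin d → ℕ} {n' : Fin d' → ℕ}
    (h : P.IsGapSequence 2 n) (h' : P.IsGapSequence 2 n') : d = d' := by
  obtain ⟨ψ, -⟩ := h
  obtain ⟨ψ', -⟩ := h'
  simpa using Fintype.card_congr (ψ.indexEquiv ψ')

theorem isGapSequence_unique (hx : C.x ∈ P.ring) {d : ℕ} {n n' : Fin d → ℕ}
    (h : P.IsGapSequence 2 n) (h' : P.IsGapSequence 2 n') : n = n' := by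
  obtain ⟨ψ, hψ, hn⟩ := h
  obtain ⟨ψ', hψ', hn'⟩ := h'
  funext i
  have h := congrFun (qOrd_basis_unique hx hψ hψ') i
  have h1 := hn i
  have h2 := hn' i
  omega

theorem ord_basisFun_add_one {m : ℕ}
    (h : ∀ j : Fin 5, P.ord (C.basisFun w s j.castSucc) = j)
    (hm : (m : ℤ) = P.ord (C.basisFun w s (Fin.last 5)) + 1) (i : Fin 6) :
    ((![1, 2, 3, 4, 5, m] i : ℕ) : ℤ) = P.ord (C.basisFun w s i) + 1 := by
  refine Fin.lastCases ?_ (fun j => ?_) i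
  · rw [← hm]; rfl
  · rw [h j]
    fin_cases j <;> rfl

theorem strictMono_gaps {m : ℕ} (hm : 6 ≤ m) : StrictMono ![1, 2, 3, 4, 5, m] := by
  refine Fin.strictMono_iff_lt_succ.2 fun i => ?_
  fin_cases i <;> simp
  omega

theorem hasWeight_iff (hx : C.x ∈ P.ring) {m : ℕ} (h : P.IsGapSequence 2 ![1, 2, 3, 4, 5, m])
    (k : ℤ) : P.HasWeight 2 k ↔ k = (m : ℤ) - 6 := by
  have hsum : ∑ i : Fin 6, (((![1, 2, 3, 4, 5, m] i : ℕ) : ℤ) - ((i : ℤ) + 1)) = (m : ℤ) - 6 := by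
    simp [Fin.sum_univ_succ]
    ring
  constructor
  · rintro ⟨d, n, hn, rfl⟩
    -- The weight quantifies over the length d as well, so invariance of dimension is needed before
    -- uniqueness.
    obtain rfl := card_of_isGapSequence hn h
    rw [isGapSequence_unique hx hn h, hsum]
  · rintro rfl
    exact ⟨6, _, h, hsum.symm⟩

end Octic

end QWeierstrass

end

/-! ### The corollary -/

theorem mainTheorem5 (C : QWeierstrass.Octic) (w s : ℂ) (hw : C.g.eval w ≠ 0)
    (P : QWeierstrass.Point C.FunctionField) (hPx : P.HasValue C.x w) (hPy : P.HasValue C.y s) :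
    ∃ n₆ : ℕ,
      (n₆ : ℤ) = P.ord (C.y - Polynomial.aeval C.x (C.taylorPoly w s)) + 1 ∧
      (∃ ψ : Module.Basis (Fin 6) ℂ (QWeierstrass.H0 C.FunctionField 2),
        (∀ i, (ψ i : QWeierstrass.QDiff C.FunctionField 2) = C.basisDiff w s i) ∧
        StrictMono (fun i => P.qOrd (ψ i : QWeierstrass.QDiff C.FunctionField 2)) ∧
        ∀ i, ((![1, 2, 3, 4, 5, n₆] i : ℕ) : ℤ) =
          P.qOrd (ψ i : QWeierstrass.QDiff C.FunctionField 2) + 1) ∧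
      (∀ n : Fin 6 → ℕ, P.IsGapSequence 2 n ↔ n = ![1, 2, 3, 4, 5, n₆]) ∧
      (6 < n₆ → P.IsWeierstrass 2 ∧ ∀ k : ℤ, P.HasWeight 2 k ↔ k = (n₆ : ℤ) - 6) := by
  have hx := hPx.mem
  obtain ⟨h1, h5⟩ := QWeierstrass.Octic.ord_basisFun hw hPx hPy
  obtain ⟨m, hm⟩ := Int.eq_ofNat_of_zero_le
    (show 0 ≤ P.ord (C.basisFun w s (Fin.last 5)) + 1 by omega)
  have hvals := QWeierstrass.Octic.ord_basisFun_add_one h1 hm.symm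
  -- The order of y - f is at least 5, so m ≥ 6 and the sequence 1, 2, 3, 4, 5, m is strictly
  -- increasing.
  have hord : StrictMono fun i => P.ord (C.basisFun w s i) := fun i j hij => by
    have h := QWeierstrass.Octic.strictMono_gaps (m := m) (by omega) hij
    have hi := hvals i
    have hj := hvals j
    dsimp only
    omega
  obtain ⟨ψ, hψ⟩ := QWeierstrass.Octic.exists_basis_eq_basisDiff hord
  have hq (i : Fin 6) : P.qOrd (ψ i : QWeierstrass.QDiff C.FunctionField 2) =
      P.ord (C.basisFun w s i) := by
    rw [QWeierstrass.Octic.qOrd_eq hx, hψ, QWeierstrass.Octic.quadCoord_basisDiff]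
  have hmono : StrictMono fun i => P.qOrd (ψ i : QWeierstrass.QDiff C.FunctionField 2) := by
    simpa only [hq] using hord
  have hn (i : Fin 6) : ((![1, 2, 3, 4, 5, m] i : ℕ) : ℤ) =
      P.qOrd (ψ i : QWeierstrass.QDiff C.FunctionField 2) + 1 := by rw [hq, hvals]
  have hgap : P.IsGapSequence 2 ![1, 2, 3, 4, 5, m] := ⟨ψ, hmono, hn⟩
  have hweight := QWeierstrass.Octic.hasWeight_iff hx hgap
  refine ⟨m, ?_, ⟨ψ, hψ, hmono, hn⟩,
    fun n => ⟨fun h => QWeierstrass.Octic.isGapSequence_unique hx h hgap, fun h => h ▸ hgap⟩,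
    fun h6 => ⟨⟨(m : ℤ) - 6, (hweight _).2 rfl, by omega⟩, hweight⟩⟩
  rw [← hm, QWeierstrass.Octic.basisFun_last]
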